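/- Let $\mathcal A$ be a finite alphabet and let $\vartheta$ be a random substitution on $\mathcal A$, i.e. a map assigning to each letter $a$ a non-empty finite set $\vartheta(a)$ of non-empty finite words, extended to words by concatenation, with powers $\vartheta^n$. Let $X_\vartheta\subset\mathcal A^{\mathbb Z}$ be the subshift of all $x$ all of whose finite subwords are subwords of words in some $\vartheta^n(a)$, and let $S$ be the left shift. A marginal of $\vartheta$ is a map $\theta$ with $\theta(a)\in\vartheta(a)$ for all $a$; its substitution matrix has entries $|\theta(b)|_a$ (number of occurrences of $a$ in $\theta(b)$). Assume that $\vartheta$ is - primitive: for some $n\ge 1$, $\vartheta^n$ has a marginal with primitive substitution matrix; - geometrically compatible: there are $\lambda>1$ and a vector $L$ with strictly positive entries that is a left eigenvector with eigenvalue $\lambda$ of the substitution matrix of every marginal of $\vartheta$; - recognisable: for every $y\in X_\vartheta$ there are a unique $x\in X_\vartheta$, a unique sequence $(v_i)_{i\in\mathbb Z}$ with $v_i\in\vartheta(x_i)$ and a unique $0\le k<|v_0|$ with $S^{-k}y=\cdots v_{-2}v_{-1}.v_0v_1\cdots$. A probability choice $\mathbf P$ consists of a probability vector $(\mathbf P_{v,a})_{v\in\vartheta(a)}$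 for each letter $a$ (zero entries are allowed). Its geometric substitution matrix is $Q(\mathbf P)_{ab}=\frac{L_a}{\lambda L_b}\sum_{v\in\vartheta(b)}\mathbf P_{v,b}|v|_a$. For an $S$-invariant Borel probability measure $\mu$ on $X_\vartheta$, let $\vartheta_{\mathbf P}(\mu)$ be the law of $\cdots v_{-1}.v_0v_1\cdots$, where $x$ has law $\mu$ and, given $x$, the words $v_i\in\vartheta(x_i)$ are chosen independently with probabilities $\mathbf P_{v_i,x_i}$. Let $r(y)=\inf\{n\ge 1: S^ny\in\vartheta(X_\vartheta)\}$, where $\vartheta(X_\vartheta)$ is the set of all $\cdots v_{-1}.v_0v_1\cdots$ with $v_i\in\vartheta(x_i)$ for all $i$ and some $x\in X_\vartheta$. The $\mathbf P$-transfer of $\mu$ is the measure $T_{\mathbf P}(\mu)$ with $$T_{\mathbf P}(\mu)(f)=\Big(\int r\,d\vartheta_{\mathbf P}(\mu)\Big)^{-1}\int\sum_{i=0}^{r-1}f\circ S^i\,d\vartheta_{\mathbf P}(\mu)$$ for all continuous $f$. Let $\mathcal P=(\mathbf P_n)_{n\in\mathbb N}$ be any sequence of probability choices. A $(\vartheta,\mathcal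 P)$ inverse limit measure is a measure $\mu$ such that $\mu=\mu_1$ for some sequence $(\mu_n)_{n\in\mathbb N}$ of $S$-invariant Borel probability measures on $X_\vartheta$ with $\mu_n=T_{\mathbf P_n}(\mu_{n+1})$ for all $n$. Then there is exactly one $(\vartheta,\mathcal P)$ inverse limit measure if and only if the sequence $Q_n=Q(\mathbf P_n)$ is ergodic in inverse time, that is, for each $n\in\mathbb N$ there is a probability vector $\pi^n$ such that $\lim_{k\to\infty}Q_nQ_{n+1}\cdots Q_{n+k}=\pi^n\mathbf 1^T$. -/

import Mathlib

open MeasureTheory Filter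
open scoped Topology ENNReal

noncomputable section

namespace RandomSubst

/-! ### Random substitutions -/

/-- A random substitution on the alphabet `A`: every letter is sent to a non-empty finite set of
non-empty finite words. -/
structure RandomSubstitution (A : Type*) where
  image : A → Finset (List A)
  image_nonempty : ∀ a, (image a).Nonempty
  ne_nil : ∀ a, ∀ v ∈ image a, v ≠ []

namespace RandomSubstitution

/-- The extension of `ϑ` to words by concatenation, `ϑ(u₁ ⋯ uₙ) = ϑ(u₁) ⋯ ϑ(uₙ)`. -/
def onWord {A : Type*} [DecidableEq A] (ϑ : RandomSubstitution A) : List A → Finset (List A)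
  | [] => {[]}
  | a :: u => Finset.image₂ (fun v w => v ++ w) (ϑ.image a) (ϑ.onWord u)

/-- The `n`-th iterate `ϑⁿ`, applied to a word. -/
def iterate {A : Type*} [DecidableEq A] (ϑ : RandomSubstitution A) :
    ℕ → List A → Finset (List A)
  | 0, u => {u}
  | n + 1, u => (ϑ.iterate n u).biUnion ϑ.onWord

/-- The language of `ϑ`: all non-empty subwords of inflation words. -/
def language {A : Type*} [DecidableEq A] (ϑ : RandomSubstitution A) : Set (List A) :=
  {v | v ≠ [] ∧ ∃ (n : ℕ) (a : A), ∃ w ∈ ϑ.iterate n [a], v <:+: w}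

end RandomSubstitution

/-- The substitution matrix `M_{ab} = |θ(b)|_a` of a deterministic substitution `θ`. -/
def substMatrix {A : Type*} [DecidableEq A] (θ : A → List A) : Matrix A A ℝ :=
  Matrix.of fun a b => ((θ b).count a : ℝ)

/-- `ϑ` is primitive if some power `ϑⁿ`, `n ≥ 1`, has a marginal whose substitution matrix is
primitive. -/
def RandomSubstitution.IsPrimitive {A : Type*} [Fintype A] [DecidableEq A]
    (ϑ : RandomSubstitution A) : Prop :=
  ∃ n : ℕ, 1 ≤ n ∧ ∃ θ : A → List A,
    (∀ a, θ a ∈ ϑ.iterate n [a]) ∧ (substMatrix θ).IsPrimitive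

/-- `ϑ` is geometrically compatible, with inflation factor `lam > 1` and strictly positive
length vector `L`: `L` is a left eigenvector with eigenvalue `lam` of the substitution matrix of
every marginal of `ϑ`. -/
structure RandomSubstitution.GeometricallyCompatible {A : Type*} [Fintype A] [DecidableEq A]
    (ϑ : RandomSubstitution A) (lam : ℝ) (L : A → ℝ) : Prop where
  one_lt : 1 < lam
  pos : ∀ a, 0 < L a
  eigen : ∀ θ : A → List A, (∀ a, θ a ∈ ϑ.image a) →
    Matrix.vecMul L (substMatrix θ) = lam • L

/-! ### Bi-infinite sequences -/

/-- The `k`-th power `Sᵏ` of the left shift on bi-infinite sequences. -/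
def shift {B : Type*} (k : ℤ) (x : ℤ → B) : ℤ → B := fun n => x (n + k)

/-- The word `x_i x_{i+1} ⋯ x_{i+n-1}` of length `n`. -/
def window {A : Type*} (x : ℤ → A) (i : ℤ) (n : ℕ) : List A :=
  (List.range n).map fun t => x (i + t)

/-- The subshift `X_ϑ`: every non-empty finite subword is in the language. -/
def RandomSubstitution.subshift {A : Type*} [DecidableEq A] (ϑ : RandomSubstitution A) :
    Set (ℤ → A) :=
  {x | ∀ (i : ℤ) (n : ℕ), 1 ≤ n → window x i n ∈ ϑ.language}

/-- The position at which the block `v_i` starts in the concatenation `⋯ v₋₂ v₋₁ . v₀ v₁ ⋯`,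
where `v₀` starts at position `0`. -/
def blockStart {A : Type*} (v : ℤ → List A) (i : ℤ) : ℤ :=
  (∑ j ∈ Finset.Ico 0 i, ((v j).length : ℤ)) - ∑ j ∈ Finset.Ico i 0, ((v j).length : ℤ)

/-- `y = ⋯ v₋₂ v₋₁ . v₀ v₁ ⋯`. -/
def IsConcat {A : Type*} (v : ℤ → List A) (y : ℤ → A) : Prop :=
  ∀ (i : ℤ) (j : ℕ) (h : j < (v i).length), y (blockStart v i + j) = (v i)[j]

theorem blockStart_succ {A : Type*} (v : ℤ → List A) (i : ℤ) :
    blockStart v (i + 1) = blockStart v i + (v i).length := by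
  unfold blockStart
  rcases lt_or_ge i 0 with h | h
  · rw [Finset.Ico_eq_empty (a := (0 : ℤ)) (b := i + 1) (by omega),
      Finset.Ico_eq_empty (a := (0 : ℤ)) (b := i) (by omega),
      ← Finset.insert_Ico_add_one_left_eq_Ico h, Finset.sum_insert (by simp)]
    simp
  · rw [Finset.Ico_eq_empty (a := i) (b := (0 : ℤ)) (by omega),
      Finset.Ico_eq_empty (a := i + 1) (b := (0 : ℤ)) (by omega),
      ← Finset.insert_Ico_right_eq_Ico_add_one h, Finset.sum_insert (by simp)]
    simp [add_comm]

theorem existsUnique_isConcat {A : Type*} (v : ℤ → List A) (hv : ∀ i, v i ≠ []) :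
    ∃! y : ℤ → A, IsConcat v y := by
  have hlen : ∀ i, 1 ≤ (v i).length := fun i => List.length_pos_iff.2 (hv i)
  have hmono : StrictMono (blockStart v) := by
    refine strictMono_int_of_lt_succ fun i => ?_
    have := hlen i
    rw [blockStart_succ]; omega
  have hstep : ∀ i : ℤ, ∀ m : ℕ, blockStart v i + m ≤ blockStart v (i + m) := by
    intro i m
    induction m with
    | zero => simp
    | succ m ih =>
      have := hmono (show i + (m : ℤ) < i + ((m + 1 : ℕ) : ℤ) by push_cast; omega)
      push_cast at *; omega
  have h0 : blockStart v 0 = 0 := by simp [blockStart]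
  have hpos : ∀ n : ℤ, ∃ p : ℤ × ℕ, p.2 < (v p.1).length ∧ blockStart v p.1 + p.2 = n := by
    intro n
    obtain ⟨i, hi, hmax⟩ : ∃ i : ℤ, blockStart v i ≤ n ∧ ∀ z, blockStart v z ≤ n → z ≤ i := by
      refine Int.exists_greatest_of_bdd ⟨n.natAbs, fun z hz => ?_⟩ ⟨-(n.natAbs : ℤ), ?_⟩
      · by_contra hlt
        have h1 := hstep 0 n.natAbs
        have h2 := hmono (show (0 : ℤ) + n.natAbs < z by omega)
        omega
      · have h1 := hstep (-(n.natAbs : ℤ)) n.natAbs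
        rw [neg_add_cancel, h0] at h1
        omega
    have hlt : n < blockStart v (i + 1) := by
      by_contra hge
      have := hmax (i + 1) (by omega)
      omega
    rw [blockStart_succ] at hlt
    exact ⟨(i, (n - blockStart v i).toNat), by simp only; omega, by simp only; omega⟩
  choose p hp1 hp2 using hpos
  refine ⟨fun n => (v (p n).1)[(p n).2]'(hp1 n), ?_, ?_⟩
  · intro i j hj
    have key : p (blockStart v i + j) = (i, j) := by
      have e := hp2 (blockStart v i + j)
      have l := hp1 (blockStart v i + j)
      have hi : (p (blockStart v i + j)).1 = i := by
        rcases lt_trichotomy (p (blockStart v i + j)).1 i with h | h | h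
        · have := hmono.monotone (show (p (blockStart v i + j)).1 + 1 ≤ i by omega)
          rw [blockStart_succ] at this
          omega
        · exact h
        · have := hmono.monotone (show i + 1 ≤ (p (blockStart v i + j)).1 by omega)
          rw [blockStart_succ] at this
          omega
      refine Prod.ext hi ?_
      rw [hi] at e
      simpa using e
    simp only [key]
  · intro y hy
    funext n
    have := hy (p n).1 (p n).2 (hp1 n)
    rw [hp2 n] at this
    exact this

/-- The concatenation `⋯ v₋₂ v₋₁ . v₀ v₁ ⋯` of non-empty words. -/
def concat {A : Type*} (v : ℤ → List A) (hv : ∀ i, v i ≠ []) : ℤ → A :=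
  (existsUnique_isConcat v hv).choose

/-- The set `ϑ(X_ϑ)` of all `⋯ v₋₁ . v₀ v₁ ⋯` with `v_i ∈ ϑ(x_i)` for all `i` and some
`x ∈ X_ϑ`. -/
def RandomSubstitution.imageSubshift {A : Type*} [DecidableEq A] (ϑ : RandomSubstitution A) :
    Set (ℤ → A) :=
  {y | ∃ x ∈ ϑ.subshift, ∃ v : ℤ → List A, (∀ i, v i ∈ ϑ.image (x i)) ∧ IsConcat v y}

/-- `ϑ` is recognisable: every `y ∈ X_ϑ` has unique recognisability data `(x, k, (v_i))`, that is,
`x ∈ X_ϑ`, `v_i ∈ ϑ(x_i)`, `0 ≤ k < |v₀|` and `S⁻ᵏ y = ⋯ v₋₂ v₋₁ . v₀ v₁ ⋯`. -/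
def RandomSubstitution.IsRecognisable {A : Type*} [DecidableEq A] (ϑ : RandomSubstitution A) :
    Prop :=
  ∀ y ∈ ϑ.subshift, ∃! d : (ℤ → A) × ℕ × (ℤ → List A),
    d.1 ∈ ϑ.subshift ∧ (∀ i, d.2.2 i ∈ ϑ.image (d.1 i)) ∧ d.2.1 < (d.2.2 0).length ∧
      IsConcat d.2.2 (shift (-(d.2.1 : ℤ)) y)

/-! ### Probability choices and the geometric substitution matrix -/

/-- A probability choice for `ϑ`: `P.prob v a` is the probability of choosing `v ∈ ϑ(a)` when `ϑ`
is applied to `a`. No non-degeneracy is required. -/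
structure ProbabilityChoice {A : Type*} (ϑ : RandomSubstitution A) where
  prob : List A → A → ℝ
  nonneg : ∀ v a, 0 ≤ prob v a
  eq_zero : ∀ v a, v ∉ ϑ.image a → prob v a = 0
  sum_eq_one : ∀ a, ∑ v ∈ ϑ.image a, prob v a = 1

namespace ProbabilityChoice

/-- The substitution matrix `M(P)_{ab} = 𝔼[|ϑ_P(b)|_a]`. -/
def expectedMatrix {A : Type*} [DecidableEq A] {ϑ : RandomSubstitution A}
    (P : ProbabilityChoice ϑ) : Matrix A A ℝ :=
  Matrix.of fun a b => ∑ v ∈ ϑ.image b, P.prob v b * (v.count a : ℝ)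

/-- The geometric substitution matrix `Q(P)_{ab} = L_a M(P)_{ab} / (lam L_b)`. -/
def geometricMatrix {A : Type*} [DecidableEq A] {ϑ : RandomSubstitution A}
    (P : ProbabilityChoice ϑ) (lam : ℝ) (L : A → ℝ) : Matrix A A ℝ :=
  Matrix.of fun a b => L a / (lam * L b) * P.expectedMatrix a b

end ProbabilityChoice

/-- Ergodicity in inverse time of a sequence of (column stochastic) matrices: for each `n` the
products `P_n P_{n+1} ⋯ P_{n+k}` converge, as `k → ∞`, to `πⁿ 𝟙ᵀ` for a probability vector `πⁿ`. -/
def IsErgodicInverseTime {A : Type*} [Fintype A] [DecidableEq A] (Q : ℕ → Matrix A A ℝ) : Prop :=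
  ∀ n : ℕ, ∃ p : A → ℝ, (∀ a, 0 ≤ p a) ∧ ∑ a, p a = 1 ∧
    Tendsto (fun k : ℕ => ((List.range (k + 1)).map fun i => Q (n + i)).prod) atTop
      (𝓝 (Matrix.vecMulVec p 1))

/-! ### Measures and the transfer operator -/

/-- The alphabet `𝓑` of all pairs `(a, v)` with `v ∈ ϑ(a)`, a finite set with its discrete
`σ`-algebra. -/
structure Block {A : Type*} (ϑ : RandomSubstitution A) where
  letter : A
  word : List A
  mem : word ∈ ϑ.image letter

instance {A : Type*} (ϑ : RandomSubstitution A) : MeasurableSpace (Block ϑ) := ⊤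

namespace ProbabilityChoice

/-- The law on `𝓑` that gives mass `P_{v,a}` to each `(a, v)`, for the given letter `a`. -/
def blockLaw {A : Type*} {ϑ : RandomSubstitution A} (P : ProbabilityChoice ϑ) (a : A) :
    Measure (Block ϑ) :=
  ∑ v ∈ (ϑ.image a).attach,
    ENNReal.ofReal (P.prob v.1 a) • Measure.dirac (⟨a, v.1, v.2⟩ : Block ϑ)

instance {A : Type*} {ϑ : RandomSubstitution A} (P : ProbabilityChoice ϑ) (a : A) :
    IsProbabilityMeasure (P.blockLaw a) := by
  constructor
  simp only [blockLaw, Measure.coe_finsetSum, Finset.sum_apply, Measure.smul_apply, measure_univ,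
    smul_eq_mul, mul_one]
  rw [← ENNReal.ofReal_sum_of_nonneg (fun v _ => P.nonneg v.1 a),
    Finset.sum_attach (ϑ.image a) (fun v => P.prob v a), P.sum_eq_one, ENNReal.ofReal_one]

theorem measurable_infinitePi_blockLaw {A : Type*} [MeasurableSpace A] [DiscreteMeasurableSpace A]
    {ϑ : RandomSubstitution A} (P : ProbabilityChoice ϑ) :
    Measurable fun x : ℤ → A => Measure.infinitePi fun i => P.blockLaw (x i) := by
  refine Measurable.measure_of_isPiSystem_of_isProbabilityMeasure
    (generateFrom_squareCylinders (α := fun _ : ℤ => Block ϑ)).symm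
    (isPiSystem_squareCylinders (fun _ => MeasurableSpace.isPiSystem_measurableSet)
      (fun _ => by simp)) ?_
  rintro _ ⟨s, t, ht, rfl⟩
  have ht' : ∀ i ∈ s, MeasurableSet (t i) := fun i _ => ht i (Set.mem_univ i)
  simp only [Measure.infinitePi_pi _ ht']
  refine Finset.measurable_prod s fun i _ => ?_
  exact (Measurable.of_discrete (f := fun a : A => P.blockLaw a (t i))).comp (measurable_pi_apply i)

/-- The Markov kernel that replaces the letters `x_i` of a bi-infinite sequence independently by
blocks `(x_i, v_i)`, where `v_i` is chosen with probability `P_{v_i,x_i}`. -/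
def blockKernel {A : Type*} [MeasurableSpace A] [DiscreteMeasurableSpace A]
    {ϑ : RandomSubstitution A} (P : ProbabilityChoice ϑ) :
    ProbabilityTheory.Kernel (ℤ → A) (ℤ → Block ϑ) where
  toFun x := Measure.infinitePi fun i => P.blockLaw (x i)
  measurable' := P.measurable_infinitePi_blockLaw

end ProbabilityChoice

/-- The sequence `⋯ v₋₁ . v₀ v₁ ⋯` belonging to a bi-infinite sequence of blocks `(x_i, v_i)`. -/
def concatBlocks {A : Type*} {ϑ : RandomSubstitution A} (b : ℤ → Block ϑ) : ℤ → A :=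
  concat (fun i => (b i).word) fun i => ϑ.ne_nil _ _ (b i).mem

/-- The measure `ϑ_P(μ)` on bi-infinite sequences: the image of `μ` under the random
substitution. -/
def ProbabilityChoice.substMeasure {A : Type*} [MeasurableSpace A] [DiscreteMeasurableSpace A]
    {ϑ : RandomSubstitution A} (P : ProbabilityChoice ϑ) (μ : Measure (ℤ → A)) :
    Measure (ℤ → A) :=
  (μ.bind P.blockKernel).map concatBlocks

/-- The first return time `r_E(y) = inf {n ≥ 1 : Sⁿ y ∈ E}`. -/
def returnTime {A : Type*} (E : Set (ℤ → A)) (y : ℤ → A) : ℕ∞ :=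
  ⨅ (n : ℕ) (_ : 1 ≤ n ∧ shift (n : ℤ) y ∈ E), (n : ℕ∞)

/-- The normalisation factor `λ_{μ,P} = ∫ r_{ϑ(X_ϑ)} dϑ_P(μ)`. -/
def ProbabilityChoice.transferNorm {A : Type*} [DecidableEq A] [MeasurableSpace A]
    [DiscreteMeasurableSpace A] {ϑ : RandomSubstitution A} (P : ProbabilityChoice ϑ)
    (μ : Measure (ℤ → A)) : ℝ≥0∞ :=
  ∫⁻ y, (returnTime ϑ.imageSubshift y : ℝ≥0∞) ∂(P.substMeasure μ)

/-- The `P`-transfer `T_P(μ)`, that is,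
`T_P(μ)(f) = λ_{μ,P}⁻¹ ϑ_P(μ)(∑_{0 ≤ i < r} f ∘ Sⁱ)` with `r` the return time to `ϑ(X_ϑ)`; the
measure is written as the sum over `i` of the images under `Sⁱ` of `ϑ_P(μ)` restricted to
`{i < r}`. -/
def ProbabilityChoice.transfer {A : Type*} [DecidableEq A] [MeasurableSpace A]
    [DiscreteMeasurableSpace A] {ϑ : RandomSubstitution A} (P : ProbabilityChoice ϑ)
    (μ : Measure (ℤ → A)) : Measure (ℤ → A) :=
  (P.transferNorm μ)⁻¹ • Measure.sum fun i : ℕ =>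
    ((P.substMeasure μ).restrict {y | (i : ℕ∞) < returnTime ϑ.imageSubshift y}).map
      (shift (i : ℤ))

/-- The set `𝓜` of shift-invariant Borel probability measures on `X_ϑ`, as measures on the full
shift that are concentrated on `X_ϑ`. For a finite alphabet with the discrete topology, the product
`σ`-algebra is the Borel `σ`-algebra. -/
def RandomSubstitution.invariantMeasures {A : Type*} [DecidableEq A] [MeasurableSpace A]
    (ϑ : RandomSubstitution A) : Set (Measure (ℤ → A)) :=
  {μ | IsProbabilityMeasure μ ∧ MeasurePreserving (shift 1) μ μ ∧ μ ϑ.subshiftᶜ = 0}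

/-- A sequence in `𝓜` is adapted to `(P_n)` if `μ_n = T_{P_n}(μ_{n+1})` for all `n`. -/
def IsAdapted {A : Type*} [DecidableEq A] [MeasurableSpace A] [DiscreteMeasurableSpace A]
    {ϑ : RandomSubstitution A} (P : ℕ → ProbabilityChoice ϑ) (μ : ℕ → Measure (ℤ → A)) : Prop :=
  (∀ n, μ n ∈ ϑ.invariantMeasures) ∧ ∀ n, μ n = (P n).transfer (μ (n + 1))

/-- An inverse limit measure: the first member of an adapted sequence. Sequences are indexed from
`0` instead of `1`. -/
def IsInverseLimitMeasure {A : Type*} [DecidableEq A] [MeasurableSpace A]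
    [DiscreteMeasurableSpace A] {ϑ : RandomSubstitution A} (P : ℕ → ProbabilityChoice ϑ)
    (μ : Measure (ℤ → A)) : Prop :=
  ∃ ν : ℕ → Measure (ℤ → A), IsAdapted P ν ∧ μ = ν 0

end RandomSubst

end

/-! Recognisability says that the return time to `ϑ(X_ϑ)` at a substituted point is the length of
its block at the origin. The transfer is therefore, up to a scalar, dual to the operator `D_P f (x)
= lam⁻¹ 𝔼[∑_{i<|v₀|} f(Sⁱ y)]` on continuous functions, where `y` is the random inflation of `x`
(`ProbabilityChoice.dual`). Geometric compatibility makes `x ↦ L (x 0)` a fixed point of every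
`D_P`, so for functionals normalised on this function the scalar disappears (`normalized_transfer`).
On functions of the letter at the origin, in the basis of indicators scaled by `L`, the operators
`D_P` act through the matrices `Q(P)`.

Iterated dual operators contract everything else: a function whose variation over points agreeing on
`[0, t)` is `O(q ^ t)` is driven exponentially fast to a function of `x 0` (`VariationLE.dual`).
Hence the first member of an adapted sequence is determined by the relative lengths of the letters
at all levels (`eq_of_letterWeight_eq`). If the `Q_n` are ergodic in inverse time, these weights
must be `πⁿ`, which gives uniqueness.

Existence comes from evaluating the iterated duals at a constant sequence `a` and passing to an
ultralimit (`exists_isAdapted_tendsto`). The limit weights are ultralimits of column `a` of the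
matrix products. Conversely, if the inverse limit measure is unique, then the whole adapted sequence
is unique, since the transfer is injective by recognisability; so all columns have the same limit
along every ultrafilter, which is ergodicity in inverse time. -/

set_option linter.unusedSectionVars false

noncomputable section

namespace RandomSubst

/-! ### Concatenations and shifts -/

section Concat

variable {A B : Type*}

@[simp]
theorem blockStart_zero (v : ℤ → List A) : blockStart v 0 = 0 := by simp [blockStart]

theorem blockStart_congr {v w : ℤ → List A} {i : ℤ}
    (h : ∀ j ∈ Finset.Ico 0 i ∪ Finset.Ico i 0, (v j).length = (w j).length) :
    blockStart v i = blockStart w i := by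
  unfold blockStart
  congr 1 <;> exact Finset.sum_congr rfl fun j hj => by rw [h j (by simp_all)]

theorem add_le_blockStart_add {v : ℤ → List A} (hv : ∀ i, v i ≠ []) (i : ℤ) (m : ℕ) :
    blockStart v i + m ≤ blockStart v (i + m) := by
  induction m with
  | zero => simp
  | succ m ih =>
    have h := List.length_pos_iff.2 (hv (i + m))
    push_cast
    rw [← add_assoc i, blockStart_succ]
    omega

theorem exists_blockStart_add_eq {v : ℤ → List A} (hv : ∀ i, v i ≠ []) (n : ℤ) :
    ∃ (i : ℤ) (j : ℕ), j < (v i).length ∧ blockStart v i + j = n := by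
  obtain ⟨i, hi, hmax⟩ : ∃ i : ℤ, blockStart v i ≤ n ∧ ∀ z, blockStart v z ≤ n → z ≤ i := by
    refine Int.exists_greatest_of_bdd ⟨n.natAbs, fun z hz => ?_⟩ ⟨-(n.natAbs : ℤ), ?_⟩
    · by_contra hlt
      have h1 := add_le_blockStart_add hv 0 z.toNat
      rw [blockStart_zero, show (0 : ℤ) + z.toNat = z by omega] at h1
      omega
    · have h1 := add_le_blockStart_add hv (-(n.natAbs : ℤ)) n.natAbs
      rw [neg_add_cancel, blockStart_zero] at h1
      omega
  have hlt : n < blockStart v (i + 1) := by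
    by_contra hge
    have := hmax (i + 1) (by omega)
    omega
  rw [blockStart_succ] at hlt
  exact ⟨i, (n - blockStart v i).toNat, by omega, by omega⟩

theorem blockStart_shift (v : ℤ → List A) (k i : ℤ) :
    blockStart (shift k v) i = blockStart v (i + k) - blockStart v k := by
  induction i using Int.induction_on with
  | zero => simp
  | succ i ih =>
    rw [blockStart_succ, ih, add_right_comm, blockStart_succ]
    simp only [shift]
    ring
  | pred i ih =>
    have h1 := blockStart_succ (shift k v) (-(i : ℤ) - 1)
    have h2 := blockStart_succ v (-(i : ℤ) - 1 + k)
    rw [show -(i : ℤ) - 1 + 1 = -i by ring] at h1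
    rw [show -(i : ℤ) - 1 + k + 1 = -i + k by ring] at h2
    simp only [shift] at h1 ih ⊢
    linarith

theorem isConcat_concat (v : ℤ → List A) (hv : ∀ i, v i ≠ []) : IsConcat v (concat v hv) :=
  (existsUnique_isConcat v hv).choose_spec.1

theorem IsConcat.eq {v : ℤ → List A} (hv : ∀ i, v i ≠ []) {y z : ℤ → A} (hy : IsConcat v y)
    (hz : IsConcat v z) : y = z :=
  (existsUnique_isConcat v hv).unique hy hz

theorem IsConcat.shift_blockStart {v : ℤ → List A} {y : ℤ → A} (h : IsConcat v y) (k : ℤ) :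
    IsConcat (shift k v) (shift (blockStart v k) y) := by
  intro i j hj
  rw [blockStart_shift]
  simp only [shift] at hj ⊢
  rw [← h (i + k) j hj]
  congr 1
  ring

@[simp]
theorem shift_zero (x : ℤ → B) : shift 0 x = x := by
  funext n
  simp [shift]

theorem shift_shift (k l : ℤ) (x : ℤ → B) : shift k (shift l x) = shift (k + l) x := by
  funext n
  simp only [shift]
  congr 1
  ring

/-- In `window` the list of indices is coerced to a list of integers as a whole, by a `flatMap`. The
form with each index cast separately is easier to rewrite. -/
theorem window_eq_map (x : ℤ → A) (i : ℤ) (n : ℕ) :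
    window x i n = (List.range n).map fun t : ℕ => x (i + (t : ℤ)) := by
  unfold window
  change List.map _ (List.flatMap (fun a : ℕ => [(a : ℤ)]) (List.range n)) = _
  rw [← List.map_eq_flatMap, List.map_map]
  rfl

theorem window_shift (k : ℤ) (x : ℤ → A) (i : ℤ) (n : ℕ) :
    window (shift k x) i n = window x (i + k) n := by
  simp only [window_eq_map, shift]
  congr 1
  funext t
  congr 1
  ring

theorem window_add (x : ℤ → A) (i : ℤ) (m n : ℕ) :
    window x i (m + n) = window x i m ++ window x (i + m) n := by
  simp [window_eq_map, List.range_add, Function.comp_def, add_assoc]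

theorem window_succ (x : ℤ → A) (i : ℤ) (n : ℕ) :
    window x i (n + 1) = x i :: window x (i + 1) n := by
  rw [add_comm, window_add]
  simp [window_eq_map]

@[simp]
theorem length_window (x : ℤ → A) (i : ℤ) (n : ℕ) : (window x i n).length = n := by
  simp [window_eq_map]

theorem window_infix_window (x : ℤ → A) {p i : ℤ} {n N : ℕ} (h1 : i ≤ p) (h2 : p + n ≤ i + N) :
    window x p n <:+: window x i N := by
  obtain ⟨a, rfl⟩ : ∃ a : ℕ, p = i + a := ⟨(p - i).toNat, by omega⟩
  obtain ⟨b, rfl⟩ : ∃ b : ℕ, N = a + n + b := ⟨N - a - n, by omega⟩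
  exact ⟨window x i a, window x (i + (a + n : ℕ)) b, by rw [window_add, window_add]⟩

theorem IsConcat.window_eq {v : ℤ → List A} {y : ℤ → A} (h : IsConcat v y) (i : ℤ) :
    window y (blockStart v i) (v i).length = v i := by
  refine List.ext_getElem (by simp) fun j h1 h2 => ?_
  rw [← h i j h2]
  simp [window_eq_map]

end Concat

/-! ### Language and subshift -/

section Language

variable {A : Type*} [DecidableEq A] {ϑ : RandomSubstitution A}

theorem RandomSubstitution.onWord_nonempty (ϑ : RandomSubstitution A) (u : List A) :
    (ϑ.onWord u).Nonempty := by
  induction u with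
  | nil => simp [onWord]
  | cons a u ih => exact Finset.Nonempty.image₂ (ϑ.image_nonempty a) ih

theorem RandomSubstitution.append_mem_onWord {u v p q : List A} (hp : p ∈ ϑ.onWord u)
    (hq : q ∈ ϑ.onWord v) : p ++ q ∈ ϑ.onWord (u ++ v) := by
  induction u generalizing p with
  | nil => simp_all [onWord]
  | cons a u ih =>
    obtain ⟨s, hs, t, ht, rfl⟩ := Finset.mem_image₂.1 hp
    rw [List.append_assoc]
    exact Finset.mem_image₂_of_mem hs (ih ht)

/-- The parts of the inflation word to the left and right of `u` can be substituted arbitrarily,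
which places `v` inside an inflation word of the next level. -/
theorem RandomSubstitution.mem_language_of_onWord {u v w : List A} (hu : u ∈ ϑ.language)
    (hv : v ∈ ϑ.onWord u) (hw : w <:+: v) (hne : w ≠ []) : w ∈ ϑ.language := by
  obtain ⟨-, n, a, z, hz, s, t, rfl⟩ := hu
  obtain ⟨s', hs'⟩ := ϑ.onWord_nonempty s
  obtain ⟨t', ht'⟩ := ϑ.onWord_nonempty t
  refine ⟨hne, n + 1, a, s' ++ v ++ t', ?_, hw.trans ⟨s', t', rfl⟩⟩
  exact Finset.mem_biUnion.2 ⟨_, hz, append_mem_onWord (append_mem_onWord hs' hv) ht'⟩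

theorem RandomSubstitution.mem_language_of_infix {u w : List A} (hu : u ∈ ϑ.language)
    (hw : w <:+: u) (hne : w ≠ []) : w ∈ ϑ.language := by
  obtain ⟨-, n, a, z, hz, h⟩ := hu
  exact ⟨hne, n, a, z, hz, hw.trans h⟩

theorem RandomSubstitution.singleton_mem_language (ϑ : RandomSubstitution A) (a : A) :
    [a] ∈ ϑ.language :=
  ⟨by simp, 0, a, [a], by simp [iterate], List.infix_rfl⟩

theorem IsConcat.exists_window_mem_onWord {x y : ℤ → A} {v : ℤ → List A}
    (hv : ∀ i, v i ∈ ϑ.image (x i)) (h : IsConcat v y) (i : ℤ) (t : ℕ) :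
    ∃ N : ℕ, blockStart v i + N = blockStart v (i + t) ∧
      window y (blockStart v i) N ∈ ϑ.onWord (window x i t) := by
  induction t generalizing i with
  | zero => exact ⟨0, by simp, by simp [window_eq_map, RandomSubstitution.onWord]⟩
  | succ t ih =>
    obtain ⟨N, h1, h2⟩ := ih (i + 1)
    rw [blockStart_succ] at h1 h2
    refine ⟨(v i).length + N, ?_, ?_⟩
    · push_cast
      rw [show i + ((t : ℤ) + 1) = i + 1 + t by ring]
      linarith
    · rw [window_succ, window_add, h.window_eq]
      exact Finset.mem_image₂_of_mem (hv i) h2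

/-- A local version of `IsConcat.mem_subshift`: only one window of `x` has to be legal.
`LegalLE.dual` needs this for points outside the subshift. -/
theorem IsConcat.window_mem_language {x y : ℤ → A} {v : ℤ → List A}
    (hv : ∀ i, v i ∈ ϑ.image (x i)) (h : IsConcat v y) {i : ℤ} {t : ℕ}
    (ht : window x i t ∈ ϑ.language) {p : ℤ} {n : ℕ} (hn : n ≠ 0) (h1 : blockStart v i ≤ p)
    (h2 : p + n ≤ blockStart v (i + t)) : window y p n ∈ ϑ.language := by
  obtain ⟨N, hN, hm⟩ := h.exists_window_mem_onWord hv i t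
  refine RandomSubstitution.mem_language_of_onWord ht hm (window_infix_window y h1 (by omega)) ?_
  rw [← List.length_pos_iff]
  simp
  omega

theorem IsConcat.mem_subshift {x y : ℤ → A} {v : ℤ → List A} (hx : x ∈ ϑ.subshift)
    (hv : ∀ i, v i ∈ ϑ.image (x i)) (h : IsConcat v y) : y ∈ ϑ.subshift := by
  intro p n hn
  have hne : ∀ i, v i ≠ [] := fun i => ϑ.ne_nil _ _ (hv i)
  have h1 := add_le_blockStart_add hne (-(p.natAbs : ℤ)) p.natAbs
  have h2 := add_le_blockStart_add hne 0 (p.natAbs + n)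
  rw [neg_add_cancel, blockStart_zero] at h1
  rw [blockStart_zero] at h2
  refine h.window_mem_language hv (hx (-(p.natAbs : ℤ)) (p.natAbs + (p.natAbs + n)) (by omega))
    (by omega) (by omega) ?_
  rw [show -(p.natAbs : ℤ) + ((p.natAbs + (p.natAbs + n) : ℕ) : ℤ) = 0 + (p.natAbs + n : ℕ) by
    push_cast; ring]
  omega

theorem RandomSubstitution.shift_mem_subshift {x : ℤ → A} (hx : x ∈ ϑ.subshift) (k : ℤ) :
    shift k x ∈ ϑ.subshift := fun i n hn => by
  rw [window_shift]
  exact hx _ n hn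

end Language

/-! ### Marginals and inflation -/

section Inflate

variable {A : Type*} {ϑ : RandomSubstitution A}

/-- The finite set `ϑ(a)` as a discrete space. -/
structure ImageWord (ϑ : RandomSubstitution A) (a : A) where
  val : List A
  mem : val ∈ ϑ.image a

instance (a : A) : Finite (ImageWord ϑ a) :=
  Finite.of_injective (fun v => (⟨v.1, v.2⟩ : {v // v ∈ ϑ.image a})) fun v w h => by
    cases v
    cases w
    simp_all
instance (a : A) : Nonempty (ImageWord ϑ a) :=
  ⟨⟨(ϑ.image_nonempty a).choose, (ϑ.image_nonempty a).choose_spec⟩⟩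
instance (a : A) : TopologicalSpace (ImageWord ϑ a) := ⊥
instance (a : A) : DiscreteTopology (ImageWord ϑ a) := ⟨rfl⟩
instance (a : A) : MeasurableSpace (ImageWord ϑ a) := ⊤
instance (a : A) : DiscreteMeasurableSpace (ImageWord ϑ a) := ⟨fun _ => trivial⟩

/-- The marginals of `ϑ`. -/
abbrev Marginal (ϑ : RandomSubstitution A) := ∀ a, ImageWord ϑ a

/-- The words obtained by applying the marginal `ω i` to the letter `x i`. -/
def inflateWord (x : ℤ → A) (ω : ℤ → Marginal ϑ) (i : ℤ) : List A := (ω i (x i)).1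

theorem inflateWord_mem (x : ℤ → A) (ω : ℤ → Marginal ϑ) (i : ℤ) :
    inflateWord x ω i ∈ ϑ.image (x i) := (ω i (x i)).2

theorem inflateWord_ne_nil (x : ℤ → A) (ω : ℤ → Marginal ϑ) (i : ℤ) : inflateWord x ω i ≠ [] :=
  ϑ.ne_nil _ _ (inflateWord_mem x ω i)

/-- The sequence obtained from `x` by applying the marginal `ω i` to the letter `x i`. -/
def inflate (x : ℤ → A) (ω : ℤ → Marginal ϑ) : ℤ → A :=
  concat (inflateWord x ω) (inflateWord_ne_nil x ω)

/-- The length of the block at the origin. -/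
def inflateLength (x : ℤ → A) (ω : ℤ → Marginal ϑ) : ℕ := (inflateWord x ω 0).length

theorem inflateLength_pos (x : ℤ → A) (ω : ℤ → Marginal ϑ) : 0 < inflateLength x ω :=
  List.length_pos_iff.2 (inflateWord_ne_nil x ω 0)

theorem isConcat_inflate (x : ℤ → A) (ω : ℤ → Marginal ϑ) :
    IsConcat (inflateWord x ω) (inflate x ω) := isConcat_concat _ _

theorem blockStart_one (v : ℤ → List A) : blockStart v 1 = (v 0).length := by
  simpa using blockStart_succ v 0

theorem inflate_shift_one (x : ℤ → A) (ω : ℤ → Marginal ϑ) :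
    inflate (shift 1 x) (shift 1 ω) = shift (inflateLength x ω) (inflate x ω) := by
  have h := (isConcat_inflate x ω).shift_blockStart 1
  rw [blockStart_one] at h
  exact (isConcat_inflate (shift 1 x) (shift 1 ω)).eq (inflateWord_ne_nil _ _) h

theorem inflate_eq_getElem (x : ℤ → A) (ω : ℤ → Marginal ϑ) {i : ℕ} (h : i < inflateLength x ω) :
    inflate x ω i = (inflateWord x ω 0)[i] := by
  simpa using isConcat_inflate x ω 0 i h

/-- The letter of an inflated sequence at a given position depends on finitely many blocks only. -/
theorem inflate_congr {x x' : ℤ → A} {ω ω' : ℤ → Marginal ϑ} {n i : ℤ} {j : ℕ}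
    (hj : j < (inflateWord x ω i).length) (hn : blockStart (inflateWord x ω) i + j = n)
    (h : ∀ k ∈ Finset.Icc (min i 0) (max i 0), inflateWord x ω k = inflateWord x' ω' k) :
    inflate x' ω' n = inflate x ω n := by
  have hi := h i (by simp)
  have e : blockStart (inflateWord x ω) i = blockStart (inflateWord x' ω') i := by
    refine blockStart_congr fun k hk => ?_
    rw [h k]
    simp only [Finset.mem_union, Finset.mem_Ico, Finset.mem_Icc] at hk ⊢
    omega
  rw [← hn, isConcat_inflate x ω i j hj, e, isConcat_inflate x' ω' i j (by rwa [← hi])]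
  simp only [hi]

/-- Block `0` starts at position `0`, so positions to the right of the origin are decided by letters
to the right of the origin. -/
theorem inflate_congr_of_lt {x x' : ℤ → A} {ω : ℤ → Marginal ϑ} {t : ℕ}
    (h : ∀ k : ℕ, k < t → x k = x' k) {n : ℕ} (hn : (n : ℤ) < blockStart (inflateWord x ω) t) :
    inflate x ω n = inflate x' ω n := by
  obtain ⟨i, j, hj, e⟩ := exists_blockStart_add_eq (inflateWord_ne_nil x ω) n
  have hmono : ∀ {a b : ℤ}, a ≤ b →
      blockStart (inflateWord x ω) a + (b - a) ≤ blockStart (inflateWord x ω) b := by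
    intro a b hab
    have := add_le_blockStart_add (inflateWord_ne_nil x ω) a (b - a).toNat
    rwa [show a + ((b - a).toNat : ℤ) = b by omega, Int.toNat_of_nonneg (by omega)] at this
  have hi0 : 0 ≤ i := by
    by_contra hc
    have h1 := hmono (show i + 1 ≤ 0 by omega)
    rw [blockStart_succ, blockStart_zero] at h1
    omega
  have hit : i < t := by
    by_contra hc
    have h1 := hmono (show (t : ℤ) ≤ i by omega)
    omega
  refine (inflate_congr hj e fun k hk => ?_).symm
  simp only [Finset.mem_Icc] at hk
  obtain ⟨k, rfl⟩ := Int.eq_ofNat_of_zero_le (a := k) (by omega)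
  simp only [inflateWord]
  rw [h k (by omega)]

/-- Each of the `t` blocks after the first has length at least one. This crude bound suffices for
the contraction estimates. -/
theorem add_inflateLength_le_blockStart (x : ℤ → A) (ω : ℤ → Marginal ϑ) (t : ℕ) :
    (t : ℤ) + inflateLength x ω ≤ blockStart (inflateWord x ω) (t + 1 : ℕ) := by
  have := add_le_blockStart_add (inflateWord_ne_nil x ω) 1 t
  rw [blockStart_one] at this
  push_cast
  rw [add_comm (t : ℤ) 1]
  unfold inflateLength
  linarith

theorem inflateLength_congr {x x' : ℤ → A} {ω : ℤ → Marginal ϑ} (h : x 0 = x' 0) :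
    inflateLength x ω = inflateLength x' ω := by
  simp only [inflateLength, inflateWord]
  rw [h]

end Inflate

/-! ### Recognisability and return times -/

section Recognisable

variable {A : Type*} [DecidableEq A] {ϑ : RandomSubstitution A}

theorem inflate_mem_subshift {x : ℤ → A} (hx : x ∈ ϑ.subshift) (ω : ℤ → Marginal ϑ) :
    inflate x ω ∈ ϑ.subshift :=
  (isConcat_inflate x ω).mem_subshift hx (inflateWord_mem x ω)

theorem imageSubshift_eq : ϑ.imageSubshift =
    (fun p : (ℤ → A) × (ℤ → Marginal ϑ) => inflate p.1 p.2) '' (ϑ.subshift ×ˢ Set.univ) := by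
  ext y
  constructor
  · rintro ⟨x, hx, v, hv, h⟩
    let w : ∀ i, ImageWord ϑ (x i) := fun i => ⟨v i, hv i⟩
    -- Only the value of the marginal at the letter `x i` is ever read, so its other values are
    -- arbitrary.
    let ω : ℤ → Marginal ϑ := fun i =>
      Function.update (fun _ => Classical.arbitrary _) (x i) (w i)
    have hω : inflateWord x ω = v := by
      funext i
      exact congrArg ImageWord.val (Function.update_self (x i) (w i) _ : ω i (x i) = w i)
    exact ⟨(x, ω), ⟨hx, trivial⟩,
      (isConcat_inflate x ω).eq (inflateWord_ne_nil _ _) (by rwa [hω])⟩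
  · rintro ⟨⟨x, ω⟩, ⟨hx, -⟩, rfl⟩
    exact ⟨x, hx, inflateWord x ω, inflateWord_mem x ω, isConcat_inflate x ω⟩

/-- The common point has recognisability data with offset `i` over `x` and with offset `0` over
`x'`; uniqueness identifies them. -/
theorem eq_of_shift_inflate_eq (hrec : ϑ.IsRecognisable) {x x' : ℤ → A} (hx : x ∈ ϑ.subshift)
    (hx' : x' ∈ ϑ.subshift) {ω ω' : ℤ → Marginal ϑ} {i : ℕ} (hi : i < inflateLength x ω)
    (h : shift i (inflate x ω) = inflate x' ω') : i = 0 ∧ x = x' := by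
  have key := (hrec _ (inflate_mem_subshift hx' ω')).unique
    (y₁ := (x, i, inflateWord x ω)) (y₂ := (x', 0, inflateWord x' ω'))
    ⟨hx, inflateWord_mem x ω, hi, ?_⟩
    ⟨hx', inflateWord_mem x' ω', inflateLength_pos x' ω', ?_⟩
  · simp only [Prod.mk.injEq] at key
    exact ⟨key.2.1, key.1⟩
  · rw [← h, shift_shift]
    simpa using isConcat_inflate x ω
  · simpa using isConcat_inflate x' ω'

theorem lt_returnTime_iff (E : Set (ℤ → A)) (y : ℤ → A) (i : ℕ) :
    (i : ℕ∞) < returnTime E y ↔ ∀ n : ℕ, 1 ≤ n → n ≤ i → shift (n : ℤ) y ∉ E := by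
  constructor
  · intro h n h1 h2 h3
    have : returnTime E y ≤ n := iInf₂_le n ⟨h1, h3⟩
    exact absurd (h.trans_le this) (by simpa using h2)
  · intro h
    have : ((i + 1 : ℕ) : ℕ∞) ≤ returnTime E y := by
      refine le_iInf₂ fun n hn => ?_
      by_contra hc
      exact h n hn.1 (by simp at hc; norm_cast at hc; omega) hn.2
    exact lt_of_lt_of_le (by norm_cast; omega) this

/-- The end of the block at the origin is a return, by `inflate_shift_one`; an earlier return would
be a point of `ϑ(X_ϑ)` with a positive offset. -/
theorem returnTime_inflate (hrec : ϑ.IsRecognisable) {x : ℤ → A} (hx : x ∈ ϑ.subshift)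
    (ω : ℤ → Marginal ϑ) :
    returnTime ϑ.imageSubshift (inflate x ω) = inflateLength x ω := by
  apply le_antisymm
  · refine iInf₂_le (inflateLength x ω) ⟨inflateLength_pos x ω, ?_⟩
    rw [imageSubshift_eq, ← inflate_shift_one]
    exact ⟨(shift 1 x, shift 1 ω), ⟨RandomSubstitution.shift_mem_subshift hx 1, trivial⟩, rfl⟩
  · refine le_iInf₂ fun n ⟨hn, hm⟩ => ?_
    by_contra hc
    rw [imageSubshift_eq] at hm
    obtain ⟨⟨x', ω'⟩, ⟨hx', -⟩, e⟩ := hm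
    have := eq_of_shift_inflate_eq hrec hx hx' (i := n) (by simpa using hc) e.symm
    omega

end Recognisable

/-! ### Topology of the inflation map -/

section Topology

variable {A : Type*} [Fintype A] [TopologicalSpace A] [DiscreteTopology A]
  {ϑ : RandomSubstitution A}

theorem continuous_shift {B : Type*} [TopologicalSpace B] (k : ℤ) :
    Continuous (shift k : (ℤ → B) → ℤ → B) :=
  continuous_pi fun n => continuous_apply (n + k)

theorem eventually_inflateWord_eq (p : (ℤ → A) × (ℤ → Marginal ϑ)) (k : ℤ) :
    ∀ᶠ p' in 𝓝 p, inflateWord p.1 p.2 k = inflateWord p'.1 p'.2 k := by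
  have hc : Continuous fun p : (ℤ → A) × (ℤ → Marginal ϑ) => (p.1 k, p.2 k) := by fun_prop
  have := hc.continuousAt.eventually_mem
    ((isOpen_discrete {(p.1 k, p.2 k)}).mem_nhds (Set.mem_singleton (p.1 k, p.2 k)))
  filter_upwards [this] with p' hp'
  simp only [Set.mem_singleton_iff, Prod.mk.injEq] at hp'
  unfold inflateWord
  rw [hp'.1, hp'.2]

theorem eventually_inflateLength_eq (p : (ℤ → A) × (ℤ → Marginal ϑ)) :
    ∀ᶠ p' in 𝓝 p, inflateLength p.1 p.2 = inflateLength p'.1 p'.2 := by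
  filter_upwards [eventually_inflateWord_eq p 0] with p' hp'
  rw [inflateLength, hp', inflateLength]

theorem continuous_inflate :
    Continuous fun p : (ℤ → A) × (ℤ → Marginal ϑ) => inflate p.1 p.2 := by
  refine continuous_pi fun n => continuous_iff_continuousAt.2 fun p => ?_
  obtain ⟨i, j, hj, e⟩ := exists_blockStart_add_eq (inflateWord_ne_nil p.1 p.2) n
  refine (continuousAt_const (y := inflate p.1 p.2 n)).congr ?_
  filter_upwards [(Finset.eventually_all (Finset.Icc (min i 0) (max i 0))).2
    fun k _ => eventually_inflateWord_eq p k] with p' hp'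
  exact (inflate_congr hj e hp').symm

/-- The sum of `f` along the block at the origin of an inflated sequence. -/
def blockSum {E : Type*} [AddCommMonoid E] (f : (ℤ → A) → E) (x : ℤ → A)
    (ω : ℤ → Marginal ϑ) : E :=
  ∑ i ∈ Finset.range (inflateLength x ω), f (shift (i : ℤ) (inflate x ω))

theorem continuous_blockSum {f : (ℤ → A) → ℝ} (hf : Continuous f) :
    Continuous fun p : (ℤ → A) × (ℤ → Marginal ϑ) => blockSum f p.1 p.2 := by
  refine continuous_iff_continuousAt.2 fun p => ?_
  have hc : Continuous fun p' : (ℤ → A) × (ℤ → Marginal ϑ) =>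
      ∑ i ∈ Finset.range (inflateLength p.1 p.2), f (shift (i : ℤ) (inflate p'.1 p'.2)) :=
    continuous_finsetSum _ fun i _ => hf.comp ((continuous_shift _).comp continuous_inflate)
  refine hc.continuousAt.congr ?_
  filter_upwards [eventually_inflateLength_eq p] with p' hp'
  rw [blockSum, hp']

/-- The maximal length of a word in the sets `ϑ(a)`. -/
def maxLength (ϑ : RandomSubstitution A) : ℕ :=
  Finset.univ.sup fun a => (ϑ.image a).sup List.length

theorem inflateLength_le (x : ℤ → A) (ω : ℤ → Marginal ϑ) : inflateLength x ω ≤ maxLength ϑ :=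
  (Finset.le_sup (f := List.length) (inflateWord_mem x ω 0)).trans
    (Finset.le_sup (f := fun a => (ϑ.image a).sup List.length) (Finset.mem_univ (x 0)))

theorem isClopen_window_mem (i : ℤ) (n : ℕ) (s : Set (List A)) :
    IsClopen {x : ℤ → A | window x i n ∈ s} := by
  have : Continuous fun x : ℤ → A => fun t : Fin n => x (i + (t : ℕ)) := by fun_prop
  have e : {x : ℤ → A | window x i n ∈ s} =
      (fun x : ℤ → A => fun t : Fin n => x (i + (t : ℕ))) ⁻¹' {u | List.ofFn u ∈ s} := by
    ext x
    simp only [Set.mem_ofPred_eq, Set.mem_preimage, window_eq_map]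
    rw [List.ofFn_eq_map, ← List.map_coe_finRange_eq_range, List.map_map]
    rfl
  rw [e]
  exact (isClopen_discrete _).preimage this

theorem isClosed_subshift [DecidableEq A] (ϑ : RandomSubstitution A) : IsClosed ϑ.subshift := by
  have : ϑ.subshift = ⋂ (i : ℤ) (n : ℕ) (_ : 1 ≤ n), {x | window x i n ∈ ϑ.language} := by
    ext x
    simp [RandomSubstitution.subshift]
  rw [this]
  exact isClosed_iInter fun i => isClosed_iInter fun n => isClosed_iInter fun _ =>
    (isClopen_window_mem i n _).1

theorem isClosed_inflate_image {F : Set (ℤ → A)} (hF : IsClosed F) :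
    IsClosed ((fun p : (ℤ → A) × (ℤ → Marginal ϑ) => inflate p.1 p.2) '' (F ×ˢ Set.univ)) :=
  ((hF.prod isClosed_univ).isCompact.image continuous_inflate).isClosed

theorem isClosed_imageSubshift [DecidableEq A] (ϑ : RandomSubstitution A) :
    IsClosed ϑ.imageSubshift := by
  rw [imageSubshift_eq]
  exact isClosed_inflate_image (isClosed_subshift ϑ)

end Topology

/-! ### The random inflation as a product measure -/

section Noise

variable {A : Type*} {ϑ : RandomSubstitution A}

theorem measurable_shift {B : Type*} [MeasurableSpace B] (k : ℤ) :
    Measurable (shift k : (ℤ → B) → ℤ → B) :=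
  measurable_pi_lambda _ fun n => measurable_pi_apply (n + k)

/-- The law on `ϑ(a)` given by a probability choice. -/
def ProbabilityChoice.wordLaw (P : ProbabilityChoice ϑ) (a : A) : Measure (ImageWord ϑ a) :=
  ∑ v ∈ (ϑ.image a).attach,
    ENNReal.ofReal (P.prob v.1 a) • Measure.dirac (⟨v.1, v.2⟩ : ImageWord ϑ a)

instance (P : ProbabilityChoice ϑ) (a : A) : IsProbabilityMeasure (P.wordLaw a) := by
  constructor
  simp only [ProbabilityChoice.wordLaw, Measure.coe_finsetSum, Finset.sum_apply,
    Measure.smul_apply, measure_univ, smul_eq_mul, mul_one]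
  rw [← ENNReal.ofReal_sum_of_nonneg (fun v _ => P.nonneg v.1 a),
    Finset.sum_attach (ϑ.image a) (fun v => P.prob v a), P.sum_eq_one, ENNReal.ofReal_one]

theorem ProbabilityChoice.integral_wordLaw (P : ProbabilityChoice ϑ) (a : A) (g : List A → ℝ) :
    ∫ v, g v.1 ∂(P.wordLaw a) = ∑ v ∈ ϑ.image a, P.prob v a * g v := by
  rw [ProbabilityChoice.wordLaw, integral_finsetSum_measure]
  · simp only [integral_smul_measure, integral_dirac, ENNReal.toReal_ofReal (P.nonneg _ _),
      smul_eq_mul]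
    exact Finset.sum_attach (ϑ.image a) fun v => P.prob v a * g v
  · intro v _
    exact Integrable.of_finite.smul_measure ENNReal.ofReal_ne_top

theorem ProbabilityChoice.blockLaw_eq_map (P : ProbabilityChoice ϑ) (a : A) :
    P.blockLaw a = (P.wordLaw a).map fun v => ⟨a, v.1, v.2⟩ := by
  have hm : Measurable fun v : ImageWord ϑ a => (⟨a, v.1, v.2⟩ : Block ϑ) := .of_discrete
  ext s hs
  rw [Measure.map_apply hm hs]
  simp only [blockLaw, wordLaw, Measure.coe_finsetSum, Finset.sum_apply, Measure.smul_apply]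
  refine Finset.sum_congr rfl fun v _ => ?_
  rw [Measure.dirac_apply' _ hs, Measure.dirac_apply' _ (hm hs)]
  rfl

variable [Fintype A]

/-- The law of a bi-infinite sequence of independent random marginals. -/
def ProbabilityChoice.noise (P : ProbabilityChoice ϑ) : Measure (ℤ → Marginal ϑ) :=
  Measure.infinitePi fun _ => Measure.pi P.wordLaw

instance (P : ProbabilityChoice ϑ) : IsProbabilityMeasure P.noise := by
  unfold ProbabilityChoice.noise
  infer_instance

theorem ProbabilityChoice.noise_map_shift (P : ProbabilityChoice ϑ) (k : ℤ) :
    P.noise.map (shift k) = P.noise := by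
  refine Measure.eq_infinitePi _ fun s t ht => ?_
  rw [Measure.map_apply (measurable_shift k) (.pi s.countable_toSet fun _ _ => ht _)]
  have : shift k ⁻¹' ((s : Set ℤ).pi t) =
      ((s.map (Equiv.addRight k).toEmbedding : Finset ℤ) : Set ℤ).pi fun j => t (j - k) := by
    ext ω
    simp only [Set.mem_preimage, Set.mem_pi, Finset.mem_coe, shift, Finset.mem_map_equiv]
    refine ⟨fun h i hi => ?_, fun h i hi => ?_⟩
    · simpa using h (i - k) (by simpa [sub_eq_add_neg] using hi)
    · simpa using h (i + k) (by simpa using hi)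
  rw [this, ProbabilityChoice.noise, Measure.infinitePi_pi _ (fun _ _ => ht _)]
  simp

theorem ProbabilityChoice.map_eval_pi_wordLaw (P : ProbabilityChoice ϑ) (a : A) :
    (Measure.pi P.wordLaw).map (fun θ => θ a) = P.wordLaw a := by
  classical
  have := Measure.pi_map_eval P.wordLaw a
  simp only [measure_univ, Finset.prod_const_one, one_smul] at this
  exact this

theorem ProbabilityChoice.integral_noise (P : ProbabilityChoice ϑ) (a : A) (g : List A → ℝ) :
    ∫ ω, g (ω 0 a).1 ∂P.noise = ∑ v ∈ ϑ.image a, P.prob v a * g v := by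
  rw [← P.integral_wordLaw]
  have h1 : Measure.map (fun ω : ℤ → Marginal ϑ => ω 0) P.noise = Measure.pi P.wordLaw := by
    exact Measure.infinitePi_map_eval _ 0
  have h2 := P.map_eval_pi_wordLaw a
  have hg : Measurable fun v : ImageWord ϑ a => g v.1 := .of_discrete
  rw [← h2, integral_map (measurable_pi_apply a).aemeasurable hg.aestronglyMeasurable, ← h1,
    integral_map (measurable_pi_apply 0).aemeasurable
      (hg.comp (measurable_pi_apply a)).aestronglyMeasurable]

end Noise

/-! ### The substituted measure as an image of a product measure -/

section Transfer

variable {A : Type*} [Fintype A] [TopologicalSpace A] [DiscreteTopology A]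
  [MeasurableSpace A] [DiscreteMeasurableSpace A] {ϑ : RandomSubstitution A}

theorem measurable_inflate :
    Measurable fun p : (ℤ → A) × (ℤ → Marginal ϑ) => inflate p.1 p.2 :=
  continuous_inflate.measurable

theorem measurable_inflateLength :
    Measurable fun p : (ℤ → A) × (ℤ → Marginal ϑ) => inflateLength p.1 p.2 :=
  (Measurable.of_discrete (f := fun q : A × Marginal ϑ => (q.2 q.1).1.length)).comp
    (by fun_prop : Measurable fun p : (ℤ → A) × (ℤ → Marginal ϑ) => (p.1 0, p.2 0))

/-- Drawing an independent marginal at every site and reading it only at the letter `x i` gives the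
same law as the kernel, while the noise no longer depends on `x`. -/
theorem ProbabilityChoice.substMeasure_eq (P : ProbabilityChoice ϑ) (μ : Measure (ℤ → A))
    [SFinite μ] :
    P.substMeasure μ = (μ.prod P.noise).map fun p => inflate p.1 p.2 := by
  classical
  let B : (ℤ → A) × (ℤ → Marginal ϑ) → ℤ → Block ϑ :=
    fun p i => ⟨p.1 i, (p.2 i (p.1 i)).1, (p.2 i (p.1 i)).2⟩
  have hB : Measurable B := measurable_pi_lambda _ fun i =>
    (Measurable.of_discrete (f := fun q : A × Marginal ϑ =>
      (⟨q.1, (q.2 q.1).1, (q.2 q.1).2⟩ : Block ϑ))).comp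
      (by fun_prop : Measurable fun p : (ℤ → A) × (ℤ → Marginal ϑ) => (p.1 i, p.2 i))
  let w : ∀ b : Block ϑ, ImageWord ϑ b.letter := fun b => ⟨b.word, b.mem⟩
  -- Any marginal with the prescribed word at the letter of the block would do. Through `D`,
  -- measurability of `concatBlocks` follows from that of `inflate`.
  let D : Block ϑ → A × Marginal ϑ := fun b =>
    (b.letter, Function.update (fun _ => Classical.arbitrary _) b.letter (w b))
  have hDw : ∀ b, (D b).2 b.letter = w b := fun b => by
    simp only [D]
    exact Function.update_self _ _ _
  have hD : Measurable D := fun s _ => trivial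
  have hc : (concatBlocks : (ℤ → Block ϑ) → ℤ → A) =
      fun b => inflate (fun i => (D (b i)).1) fun i => (D (b i)).2 := by
    funext b
    refine (isConcat_concat _ _).eq (fun i => ϑ.ne_nil _ _ (b i).mem) ?_
    convert! isConcat_inflate (fun i => (D (b i)).1) fun i => (D (b i)).2 using 1
    funext i
    exact (congrArg ImageWord.val (hDw (b i))).symm
  have hcm : Measurable (concatBlocks : (ℤ → Block ϑ) → ℤ → A) := by
    rw [hc]
    exact measurable_inflate.comp (f := fun b : ℤ → Block ϑ =>
      ((fun i => (D (b i)).1 : ℤ → A), (fun i => (D (b i)).2 : ℤ → Marginal ϑ))) (by fun_prop)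
  have hK : ∀ x, P.blockKernel x = P.noise.map fun ω => B (x, ω) := by
    intro x
    change Measure.infinitePi _ = _
    rw [ProbabilityChoice.noise]
    refine Eq.trans ?_ (Measure.infinitePi_map_pi (fun _ : ℤ => Measure.pi P.wordLaw)
      (f := fun i (θ : Marginal ϑ) => (⟨x i, (θ (x i)).1, (θ (x i)).2⟩ : Block ϑ))
      fun i => .of_discrete).symm
    congr 1
    funext i
    have h2 := P.map_eval_pi_wordLaw (x i)
    rw [P.blockLaw_eq_map, ← h2, Measure.map_map .of_discrete .of_discrete]
    rfl
  have hbind : μ.bind P.blockKernel = (μ.prod P.noise).map B := by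
    ext s hs
    rw [Measure.bind_apply hs P.blockKernel.measurable.aemeasurable, Measure.map_apply hB hs,
      Measure.prod_apply (hB hs)]
    refine lintegral_congr fun x => ?_
    rw [hK, Measure.map_apply (f := fun ω => B (x, ω)) (hB.comp measurable_prodMk_left) hs]
    rfl
  rw [ProbabilityChoice.substMeasure, hbind, Measure.map_map hcm hB]
  rfl

end Transfer

/-! ### The transfer as an integral over the random inflation -/

section TransferFormula

variable {A : Type*} [Fintype A] [DecidableEq A] [TopologicalSpace A] [DiscreteTopology A]
  [MeasurableSpace A] [DiscreteMeasurableSpace A] {ϑ : RandomSubstitution A}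

theorem measurableSet_lt_returnTime (ϑ : RandomSubstitution A) (i : ℕ) :
    MeasurableSet {y | (i : ℕ∞) < returnTime ϑ.imageSubshift y} := by
  have : {y | (i : ℕ∞) < returnTime ϑ.imageSubshift y} =
      ⋂ (n : ℕ) (_ : 1 ≤ n) (_ : n ≤ i), shift (n : ℤ) ⁻¹' (ϑ.imageSubshift)ᶜ := by
    ext y
    simp [lt_returnTime_iff]
  rw [this]
  exact .iInter fun n => .iInter fun _ => .iInter fun _ =>
    measurable_shift _ (isClosed_imageSubshift ϑ).measurableSet.compl

theorem measurable_returnTime (ϑ : RandomSubstitution A) :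
    Measurable (returnTime ϑ.imageSubshift) := by
  refine ENat.measurable_iff.2 fun n => ?_
  have : returnTime ϑ.imageSubshift ⁻¹' {(n : ℕ∞)} =
      (⋂ (i : ℕ) (_ : i < n), {y | (i : ℕ∞) < returnTime ϑ.imageSubshift y}) \
        {y | (n : ℕ∞) < returnTime ϑ.imageSubshift y} := by
    ext y
    simp only [Set.mem_preimage, Set.mem_singleton_iff, Set.mem_sdiff, Set.mem_iInter,
      Set.mem_ofPred_eq, not_lt]
    constructor
    · rintro h
      rw [h]
      exact ⟨fun i hi => by exact_mod_cast hi, le_rfl⟩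
    · rintro ⟨h1, h2⟩
      obtain ⟨k, hk⟩ := ENat.ne_top_iff_exists.1 (ne_top_of_le_ne_top (ENat.natCast_ne_top n) h2)
      rw [← hk] at h1 h2 ⊢
      norm_cast at h2 ⊢
      by_contra hc
      have := h1 k (by omega)
      exact lt_irrefl _ this
  rw [this]
  exact (MeasurableSet.iInter fun i => .iInter fun _ => measurableSet_lt_returnTime ϑ i).diff
    (measurableSet_lt_returnTime ϑ n)

namespace ProbabilityChoice

variable (P : ProbabilityChoice ϑ) {μ : Measure (ℤ → A)}

theorem ae_mem_subshift [SFinite μ] (hμ : μ ϑ.subshiftᶜ = 0) :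
    ∀ᵐ p ∂(μ.prod P.noise), p.1 ∈ ϑ.subshift :=
  Measure.quasiMeasurePreserving_fst.ae (mem_ae_iff.2 hμ)

theorem measurableSet_lt_inflateLength (i : ℕ) :
    MeasurableSet {p : (ℤ → A) × (ℤ → Marginal ϑ) | i < inflateLength p.1 p.2} :=
  measurableSet_lt measurable_const measurable_inflateLength

theorem transferNorm_eq (hrec : ϑ.IsRecognisable) [SFinite μ] (hμ : μ ϑ.subshiftᶜ = 0) :
    P.transferNorm μ = ∫⁻ p, (inflateLength p.1 p.2 : ℝ≥0∞) ∂(μ.prod P.noise) := by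
  rw [transferNorm, substMeasure_eq, lintegral_map ?_ measurable_inflate]
  · refine lintegral_congr_ae ?_
    filter_upwards [P.ae_mem_subshift hμ] with p hp
    rw [returnTime_inflate hrec hp]
    rfl
  · exact (Measurable.of_discrete (f := fun n : ℕ∞ => (n : ℝ≥0∞))).comp (measurable_returnTime ϑ)

theorem one_le_transferNorm (hrec : ϑ.IsRecognisable) [IsProbabilityMeasure μ]
    (hμ : μ ϑ.subshiftᶜ = 0) : 1 ≤ P.transferNorm μ := by
  rw [P.transferNorm_eq hrec hμ]
  calc (1 : ℝ≥0∞) = ∫⁻ _, 1 ∂(μ.prod P.noise) := by simp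
    _ ≤ _ := lintegral_mono fun p => Nat.one_le_cast.2 (inflateLength_pos p.1 p.2)

theorem transferNorm_ne_top (hrec : ϑ.IsRecognisable) [IsProbabilityMeasure μ]
    (hμ : μ ϑ.subshiftᶜ = 0) : P.transferNorm μ ≠ ⊤ := by
  rw [P.transferNorm_eq hrec hμ]
  refine ne_top_of_le_ne_top (b := ∫⁻ _, (maxLength ϑ : ℝ≥0∞) ∂(μ.prod P.noise)) (by simp) ?_
  exact lintegral_mono fun p => Nat.cast_le.2 (inflateLength_le p.1 p.2)

/-- Almost surely the return time is the length of the first block, which is bounded, so the sum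
over `i` becomes finite. -/
theorem transfer_eq (hrec : ϑ.IsRecognisable) [SFinite μ] (hμ : μ ϑ.subshiftᶜ = 0) :
    P.transfer μ = (P.transferNorm μ)⁻¹ • ∑ i ∈ Finset.range (maxLength ϑ),
      ((μ.prod P.noise).restrict {p | i < inflateLength p.1 p.2}).map
        fun p => shift (i : ℤ) (inflate p.1 p.2) := by
  have h (i : ℕ) : ((P.substMeasure μ).restrict
        {y | (i : ℕ∞) < returnTime ϑ.imageSubshift y}).map (shift (i : ℤ)) =
      ((μ.prod P.noise).restrict {p | i < inflateLength p.1 p.2}).map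
        fun p => shift (i : ℤ) (inflate p.1 p.2) := by
    rw [substMeasure_eq, Measure.restrict_map measurable_inflate (measurableSet_lt_returnTime ϑ i),
      Measure.map_map (measurable_shift _) measurable_inflate]
    congr 1
    refine Measure.restrict_congr_set ?_
    filter_upwards [P.ae_mem_subshift hμ] with p hp
    have := returnTime_inflate hrec hp p.2
    apply propext
    change (i : ℕ∞) < returnTime ϑ.imageSubshift (inflate p.1 p.2) ↔ _
    rw [this]
    exact Nat.cast_lt
  simp only [transfer, h]
  congr 1
  ext s hs
  rw [Measure.sum_apply _ hs, Measure.finsetSum_apply, tsum_eq_sum]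
  intro i hi
  have : {p : (ℤ → A) × (ℤ → Marginal ϑ) | i < inflateLength p.1 p.2} = ∅ := by
    ext p
    have := inflateLength_le p.1 p.2
    simp at hi ⊢
    omega
  simp [this]

theorem integrable_of_continuous {X : Type*} [TopologicalSpace X] [CompactSpace X]
    [MeasurableSpace X] [OpensMeasurableSpace X] {ν : Measure X} [IsFiniteMeasure ν]
    {f : X → ℝ} (hf : Continuous f) : Integrable f ν := by
  exact hf.integrable_of_hasCompactSupport (HasCompactSupport.of_compactSpace f)

theorem integral_transfer (hrec : ϑ.IsRecognisable) [IsProbabilityMeasure μ]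
    (hμ : μ ϑ.subshiftᶜ = 0) {f : (ℤ → A) → ℝ} (hf : Continuous f) :
    ∫ y, f y ∂(P.transfer μ) =
      (P.transferNorm μ).toReal⁻¹ * ∫ x, ∫ ω, blockSum f x ω ∂P.noise ∂μ := by
  have hm (i : ℕ) : Continuous fun p : (ℤ → A) × (ℤ → Marginal ϑ) =>
      shift (i : ℤ) (inflate p.1 p.2) := (continuous_shift _).comp continuous_inflate
  have hi (i : ℕ) : Integrable (fun p : (ℤ → A) × (ℤ → Marginal ϑ) =>
      f (shift (i : ℤ) (inflate p.1 p.2))) (μ.prod P.noise) :=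
    integrable_of_continuous (hf.comp (hm i))
  rw [P.transfer_eq hrec hμ, integral_smul_measure, integral_finsetSum_measure, smul_eq_mul,
    ENNReal.toReal_inv, ← integral_prod _ (integrable_of_continuous (continuous_blockSum hf))]
  swap
  · exact fun i _ => integrable_of_continuous hf
  congr 1
  have e (i : ℕ) : ∫ y, f y ∂(((μ.prod P.noise).restrict {p | i < inflateLength p.1 p.2}).map
        fun p => shift (i : ℤ) (inflate p.1 p.2)) =
      ∫ p, ({p | i < inflateLength p.1 p.2} : Set ((ℤ → A) × (ℤ → Marginal ϑ))).indicator
        (fun p => f (shift (i : ℤ) (inflate p.1 p.2))) p ∂(μ.prod P.noise) := by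
    rw [integral_map (hm i).measurable.aemeasurable hf.aestronglyMeasurable,
      integral_indicator (measurableSet_lt_inflateLength i)]
  simp only [e]
  rw [← integral_finsetSum _ fun i _ => (hi i).indicator (measurableSet_lt_inflateLength i)]
  refine integral_congr_ae (.of_forall fun p => ?_)
  simp only [Set.indicator_apply, Set.mem_ofPred_eq, blockSum]
  rw [← Finset.sum_filter]
  congr 1
  ext i
  have := inflateLength_le p.1 p.2
  simp
  omega

/-- By recognisability only the unshifted copy `i = 0` meets the inflation of `F`, and it does so
exactly over `F`. The transfer thus remembers `μ F` up to normalisation. -/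
theorem transfer_inflate_image (hrec : ϑ.IsRecognisable) [SFinite μ]
    (hμ : μ ϑ.subshiftᶜ = 0) {F : Set (ℤ → A)} (hF : IsClosed F) (hFX : F ⊆ ϑ.subshift) :
    P.transfer μ ((fun p : (ℤ → A) × (ℤ → Marginal ϑ) => inflate p.1 p.2) '' (F ×ˢ Set.univ)) =
      (P.transferNorm μ)⁻¹ * μ F := by
  set E := (fun p : (ℤ → A) × (ℤ → Marginal ϑ) => inflate p.1 p.2) '' (F ×ˢ Set.univ) with hE
  have hEm : MeasurableSet E := (isClosed_inflate_image hF).measurableSet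
  have hm (i : ℕ) : Measurable fun p : (ℤ → A) × (ℤ → Marginal ϑ) =>
      shift (i : ℤ) (inflate p.1 p.2) := (measurable_shift _).comp measurable_inflate
  rw [P.transfer_eq hrec hμ, Measure.smul_apply, Measure.finsetSum_apply, smul_eq_mul]
  congr 1
  have e (i : ℕ) : (((μ.prod P.noise).restrict {p | i < inflateLength p.1 p.2}).map
        fun p => shift (i : ℤ) (inflate p.1 p.2)) E = if i = 0 then μ F else 0 := by
    rw [Measure.map_apply (hm i) hEm, Measure.restrict_apply (hm i hEm)]
    have h : ((fun p : (ℤ → A) × (ℤ → Marginal ϑ) => shift (i : ℤ) (inflate p.1 p.2)) ⁻¹' E ∩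
        {p | i < inflateLength p.1 p.2} : Set _) =ᵐ[μ.prod P.noise]
        (if i = 0 then F ×ˢ Set.univ else ∅ : Set ((ℤ → A) × (ℤ → Marginal ϑ))) := by
      filter_upwards [P.ae_mem_subshift hμ] with p hp
      apply propext
      change (shift (i : ℤ) (inflate p.1 p.2) ∈ E ∧ i < inflateLength p.1 p.2) ↔
        p ∈ (if i = 0 then F ×ˢ Set.univ else ∅ : Set ((ℤ → A) × (ℤ → Marginal ϑ)))
      constructor
      · rintro ⟨⟨⟨x', ω'⟩, ⟨hx', -⟩, e⟩, hlt⟩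
        obtain ⟨rfl, h2⟩ := eq_of_shift_inflate_eq hrec hp (hFX hx') hlt e.symm
        simpa [h2] using hx'
      · split_ifs with h0
        · subst h0
          rintro ⟨h1, -⟩
          refine ⟨⟨p, ⟨h1, trivial⟩, by simp⟩, inflateLength_pos _ _⟩
        · exact fun h => h.elim
    rw [measure_congr h]
    split_ifs
    · rw [Measure.prod_prod, measure_univ, mul_one]
    · simp
  simp only [e]
  rcases isEmpty_or_nonempty (ℤ → A) with h | ⟨⟨x⟩⟩
  · simp [Set.eq_empty_of_isEmpty F]
  · have : 0 < maxLength ϑ :=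
      (inflateLength_pos x (fun _ _ => Classical.arbitrary _)).trans_le (inflateLength_le x _)
    simp [this]

/-- On measures concentrated on the subshift, the transfer is injective. -/
theorem transfer_injective (hrec : ϑ.IsRecognisable) {μ' : Measure (ℤ → A)}
    [IsProbabilityMeasure μ] [IsProbabilityMeasure μ'] (hμ : μ ϑ.subshiftᶜ = 0)
    (hμ' : μ' ϑ.subshiftᶜ = 0) (h : P.transfer μ = P.transfer μ') : μ = μ' := by
  have hX := isClosed_subshift ϑ
  have huniv {ν : Measure (ℤ → A)} (hν : ν ϑ.subshiftᶜ = 0) (F : Set (ℤ → A)) :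
      ν (F ∩ ϑ.subshift) = ν F :=
    measure_inter_conull hν
  have key {F : Set (ℤ → A)} (hF : IsClosed F) :
      (P.transferNorm μ)⁻¹ * μ F = (P.transferNorm μ')⁻¹ * μ' F := by
    rw [← huniv hμ F, ← huniv hμ' F,
      ← P.transfer_inflate_image hrec hμ (hF.inter hX) Set.inter_subset_right, h,
      P.transfer_inflate_image hrec hμ' (hF.inter hX) Set.inter_subset_right]
  -- Both measures have total mass one, so taking `F` to be the whole space compares the
  -- normalisations.
  have hN : (P.transferNorm μ)⁻¹ = (P.transferNorm μ')⁻¹ := by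
    simpa using key isClosed_univ
  refine ext_of_generate_finite _ (borel_eq_generateFrom_isClosed (α := ℤ → A) ▸
    BorelSpace.measurable_eq) isPiSystem_isClosed (fun F hF => ?_) (by simp)
  have := key hF
  rw [hN] at this
  refine (ENNReal.mul_right_inj ?_ ?_).1 this
  · simpa using P.transferNorm_ne_top hrec hμ'
  · exact ENNReal.inv_ne_top.2 (zero_lt_one.trans_le (P.one_le_transferNorm hrec hμ')).ne'

end ProbabilityChoice

end TransferFormula

/-! ### The dual of the transfer on continuous functions -/

section Dual

variable {A : Type*} [TopologicalSpace A]

/-- Composition of a continuous function with the shift. -/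
def shiftComp (f : C(ℤ → A, ℝ)) : C(ℤ → A, ℝ) := f.comp ⟨shift 1, continuous_shift 1⟩

@[simp]
theorem shiftComp_apply (f : C(ℤ → A, ℝ)) (x : ℤ → A) : shiftComp f x = f (shift 1 x) := rfl

/-- A function of the letter at the origin, as a continuous function. -/
def letterFun [DiscreteTopology A] (g : A → ℝ) : C(ℤ → A, ℝ) :=
  ⟨fun x => g (x 0), continuous_of_discreteTopology.comp (continuous_apply 0)⟩

@[simp]
theorem letterFun_apply [DiscreteTopology A] (g : A → ℝ) (x : ℤ → A) :
    letterFun g x = g (x 0) := rfl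

variable [DiscreteTopology A] [Fintype A] {ϑ : RandomSubstitution A}

namespace ProbabilityChoice

theorem continuous_integral_noise (P : ProbabilityChoice ϑ)
    {h : (ℤ → A) × (ℤ → Marginal ϑ) → ℝ} (hh : Continuous h) :
    Continuous fun x => ∫ ω, h (x, ω) ∂P.noise := by
  have := continuous_parametric_integral_of_continuous (μ := P.noise)
    (f := fun x ω => h (x, ω)) hh isCompact_univ
  simpa using this

/-- The expectation of `f` at the random inflation of `x`. -/
def expectation (P : ProbabilityChoice ϑ) (f : C(ℤ → A, ℝ)) : C(ℤ → A, ℝ) :=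
  ⟨fun x => ∫ ω, f (inflate x ω) ∂P.noise,
    P.continuous_integral_noise (f.continuous.comp continuous_inflate)⟩

theorem integrable_comp_inflate (P : ProbabilityChoice ϑ) (f : C(ℤ → A, ℝ)) (x : ℤ → A) :
    Integrable (fun ω => f (inflate x ω)) P.noise :=
  integrable_of_continuous
    (f.continuous.comp (continuous_inflate.comp (Continuous.prodMk_right x)))

theorem integrable_blockSum (P : ProbabilityChoice ϑ) (f : C(ℤ → A, ℝ)) (x : ℤ → A) :
    Integrable (fun ω => blockSum f x ω) P.noise :=
  integrable_of_continuous
    ((continuous_blockSum f.continuous).comp (Continuous.prodMk_right x))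

/-- The dual of the transfer, up to normalisation. -/
def dual (P : ProbabilityChoice ϑ) (lam : ℝ) : C(ℤ → A, ℝ) →ₗ[ℝ] C(ℤ → A, ℝ) where
  toFun f := ⟨fun x => lam⁻¹ * ∫ ω, blockSum f x ω ∂P.noise,
    continuous_const.mul (P.continuous_integral_noise (continuous_blockSum f.continuous))⟩
  map_add' f g := by
    ext x
    simp only [ContinuousMap.coe_mk, ContinuousMap.add_apply]
    rw [← mul_add, ← integral_add (P.integrable_blockSum f x) (P.integrable_blockSum g x)]
    simp [blockSum, Finset.sum_add_distrib]
  map_smul' c f := by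
    ext x
    simp only [ContinuousMap.coe_mk, ContinuousMap.smul_apply, smul_eq_mul, RingHom.id_apply]
    have (ω : ℤ → Marginal ϑ) : blockSum (c • f : C(ℤ → A, ℝ)) x ω = c * blockSum f x ω := by
      simp [blockSum, Finset.mul_sum]
    simp only [this, integral_const_mul]
    ring

theorem dual_apply (P : ProbabilityChoice ϑ) (lam : ℝ) (f : C(ℤ → A, ℝ)) (x : ℤ → A) :
    P.dual lam f x = lam⁻¹ * ∫ ω, blockSum f x ω ∂P.noise := rfl

variable (P : ProbabilityChoice ϑ) {lam : ℝ}

theorem dual_mono (hlam : 0 ≤ lam) {f g : C(ℤ → A, ℝ)} (h : f ≤ g) :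
    P.dual lam f ≤ P.dual lam g := fun x => by
  change P.dual lam f x ≤ P.dual lam g x
  rw [dual_apply, dual_apply]
  refine mul_le_mul_of_nonneg_left (integral_mono (P.integrable_blockSum f x)
    (P.integrable_blockSum g x) fun ω => ?_) (inv_nonneg.2 hlam)
  exact Finset.sum_le_sum fun i _ => h _

/-- The sum along the block telescopes to its two ends, and shift-invariance of the noise removes
the shift of `ω`. Coboundaries stay coboundaries and gain a factor `lam⁻¹`, which makes limit
functionals shift-invariant. -/
theorem dual_shiftComp_sub (f : C(ℤ → A, ℝ)) :
    P.dual lam (shiftComp f - f) =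
      lam⁻¹ • (shiftComp (P.expectation f) - P.expectation f) := by
  ext x
  have h (ω : ℤ → Marginal ϑ) : blockSum (shiftComp f - f : C(ℤ → A, ℝ)) x ω =
      f (inflate (shift 1 x) (shift 1 ω)) - f (inflate x ω) := by
    rw [inflate_shift_one]
    have := Finset.sum_range_sub (fun i : ℕ => f (shift (i : ℤ) (inflate x ω)))
      (inflateLength x ω)
    simp only [Nat.cast_zero, shift_zero] at this
    rw [← this]
    refine Finset.sum_congr rfl fun i _ => ?_
    simp [shift_shift, add_comm]
  have e : ∫ ω, f (inflate (shift 1 x) (shift 1 ω)) ∂P.noise =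
      ∫ ω, f (inflate (shift 1 x) ω) ∂P.noise := by
    conv_rhs => rw [← P.noise_map_shift 1]
    rw [integral_map (measurable_shift 1).aemeasurable]
    exact (f.continuous.comp
      (continuous_inflate.comp (Continuous.prodMk_right (shift 1 x)))).aestronglyMeasurable
  have hi : Integrable (fun ω => f (inflate (shift 1 x) (shift 1 ω))) P.noise :=
    integrable_of_continuous (f.continuous.comp (continuous_inflate.comp
      ((Continuous.prodMk_right (shift 1 x)).comp (continuous_shift 1))))
  rw [dual_apply]
  simp only [h]
  rw [integral_sub hi (P.integrable_comp_inflate f x), e]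
  rfl

theorem norm_expectation_le (f : C(ℤ → A, ℝ)) : ‖P.expectation f‖ ≤ ‖f‖ := by
  refine (ContinuousMap.norm_le _ (norm_nonneg f)).2 fun x => ?_
  refine (norm_integral_le_of_norm_le_const (.of_forall fun ω => f.norm_coe_le_norm _)).trans ?_
  simp

theorem blockSum_letterFun {g : A → ℝ} (x : ℤ → A) (ω : ℤ → Marginal ϑ) :
    blockSum (fun y => g (y 0)) x ω = ((inflateWord x ω 0).map g).sum := by
  rw [blockSum, Finset.sum_range, ← List.sum_ofFn]
  congr 1
  refine List.ext_getElem (by simp [inflateLength]) fun j h1 h2 => ?_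
  simp only [List.length_ofFn] at h1
  simp only [List.getElem_ofFn, List.getElem_map, shift, zero_add]
  rw [inflate_eq_getElem x ω h1]
  rfl

theorem dual_letterFun (g : A → ℝ) : P.dual lam (letterFun g) =
    letterFun fun a => lam⁻¹ * ∑ v ∈ ϑ.image a, P.prob v a * (v.map g).sum := by
  ext x
  rw [dual_apply, letterFun_apply, ← P.integral_noise (x 0) fun v => (v.map g).sum]
  congr 1
  exact integral_congr_ae (.of_forall fun ω => blockSum_letterFun x ω)

end ProbabilityChoice

variable [DecidableEq A]

theorem sum_map_eq_sum_count (g : A → ℝ) (v : List A) :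
    (v.map g).sum = ∑ b, g b * v.count b := by
  rw [Finset.sum_list_map_count, Finset.sum_subset (Finset.subset_univ _)]
  · simp [mul_comm]
  · intro b _ hb
    simp [List.count_eq_zero.2 (by simpa using hb)]

theorem RandomSubstitution.GeometricallyCompatible.sum_map {lam : ℝ} {L : A → ℝ}
    (h : ϑ.GeometricallyCompatible lam L) {a : A} {v : List A} (hv : v ∈ ϑ.image a) :
    (v.map L).sum = lam * L a := by
  -- Component `a` of the eigenvector equation, for a marginal that uses the given word at `a` and
  -- arbitrary words elsewhere.
  have := congrFun (h.eigen (Function.update (fun b => (ϑ.image_nonempty b).choose) a v) ?_) a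
  · rw [sum_map_eq_sum_count]
    simpa [Matrix.vecMul, dotProduct, substMatrix] using this
  · intro b
    rcases eq_or_ne b a with rfl | hb
    · simpa using hv
    · simpa [hb] using (ϑ.image_nonempty b).choose_spec

namespace ProbabilityChoice

variable (P : ProbabilityChoice ϑ) {lam : ℝ} {L : A → ℝ}

theorem dual_letterFun_length (h : ϑ.GeometricallyCompatible lam L) :
    P.dual lam (letterFun L) = letterFun L := by
  rw [dual_letterFun]
  congr 1
  funext a
  rw [Finset.sum_congr rfl fun v hv => by rw [h.sum_map hv], ← Finset.sum_mul, P.sum_eq_one,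
    one_mul, inv_mul_cancel_left₀ (zero_lt_one.trans h.one_lt).ne']

/-- Scaling the indicators by `L` turns the expected substitution matrix, divided by `lam`, into the
geometric one. -/
theorem dual_letterFun_single (h : ϑ.GeometricallyCompatible lam L) (b : A) :
    P.dual lam (letterFun (Pi.single b (L b))) =
      ∑ a, P.geometricMatrix lam L b a • letterFun (Pi.single a (L a)) := by
  rw [dual_letterFun]
  ext x
  rw [ContinuousMap.sum_apply, Finset.sum_eq_single (x 0)]
  · have hL := (h.pos (x 0)).ne'
    have hlam := (zero_lt_one.trans h.one_lt).ne'
    simp only [letterFun_apply, ContinuousMap.smul_apply, Pi.single_eq_same, smul_eq_mul,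
      geometricMatrix, expectedMatrix, Matrix.of_apply, sum_map_eq_sum_count]
    have (v : List A) : ∑ c, (Pi.single b (L b) : A → ℝ) c * (v.count c : ℝ) =
        L b * v.count b := by
      rw [Finset.sum_eq_single b] <;> simp +contextual
    simp only [this, mul_left_comm _ (L b), ← Finset.mul_sum]
    field_simp
  · intro c _ hc
    simp [hc.symm]
  · simp

end ProbabilityChoice

end Dual

/-! ### Contraction of the dual operators -/

section Contraction

/-- The exponents run through `t + 1, …, t + l`, so a geometric series bounds the sum uniformly in
the block length `l`. -/
theorem sum_range_pow_le {q : ℝ} (hq0 : 0 ≤ q) (hq1 : q < 1) (t l : ℕ) :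
    ∑ i ∈ Finset.range l, q ^ (t + (l - i)) ≤ q ^ (t + 1) / (1 - q) := by
  rw [← Finset.sum_range_reflect]
  have : ∀ j ∈ Finset.range l, q ^ (t + (l - (l - 1 - j))) = q ^ (t + 1) * q ^ j := by
    intro j hj
    have := Finset.mem_range.1 hj
    rw [← pow_add]
    congr 1
    omega
  rw [Finset.sum_congr rfl this, ← Finset.mul_sum, div_eq_mul_inv]
  refine mul_le_mul_of_nonneg_left ?_ (by positivity)
  rw [← tsum_geometric_of_lt_one hq0 hq1]
  exact (summable_geometric_of_lt_one hq0 hq1).sum_le_tsum _ fun i _ => by positivity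

variable {A : Type*} [TopologicalSpace A]

/-- The values of `f` at two points that agree on `[0, t)` differ by at most `C * q ^ t`. -/
def VariationLE (f : C(ℤ → A, ℝ)) (C q : ℝ) : Prop :=
  ∀ t : ℕ, t ≠ 0 → ∀ x x' : ℤ → A, (∀ k : ℕ, k < t → x k = x' k) → |f x - f x'| ≤ C * q ^ t

/-- The values of `f` at points for which the word on `[0, t)` is legal are at most `C * q ^ t`. -/
def LegalLE [DecidableEq A] (ϑ : RandomSubstitution A) (f : C(ℤ → A, ℝ)) (C q : ℝ) : Prop :=
  ∀ t : ℕ, t ≠ 0 → ∀ x : ℤ → A, window x 0 t ∈ ϑ.language → |f x| ≤ C * q ^ t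

variable [DiscreteTopology A] [Fintype A] {ϑ : RandomSubstitution A}

theorem abs_integral_noise_le (P : ProbabilityChoice ϑ) {lam C q : ℝ} (hlam : 0 < lam)
    (hC : 0 ≤ C) (hq0 : 0 ≤ q) (hq1 : q < 1) {t : ℕ} {l : (ℤ → Marginal ϑ) → ℕ}
    {h : (ℤ → Marginal ϑ) → ℝ}
    (hh : ∀ ω, |h ω| ≤ ∑ i ∈ Finset.range (l ω), C * q ^ (t + (l ω - i))) :
    |lam⁻¹ * ∫ ω, h ω ∂P.noise| ≤ C * (lam * (1 - q))⁻¹ * q ^ (t + 1) := by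
  have hb : ‖∫ ω, h ω ∂P.noise‖ ≤ C * (q ^ (t + 1) / (1 - q)) := by
    refine (norm_integral_le_of_norm_le_const (C := C * (q ^ (t + 1) / (1 - q)))
      (.of_forall fun ω => (hh ω).trans ?_)).trans_eq (by simp)
    rw [← Finset.mul_sum]
    exact mul_le_mul_of_nonneg_left (sum_range_pow_le hq0 hq1 t _) hC
  rw [abs_mul, abs_of_nonneg (inv_nonneg.2 hlam.le)]
  refine (mul_le_mul_of_nonneg_left hb (inv_nonneg.2 hlam.le)).trans_eq ?_
  rw [mul_inv, div_eq_mul_inv]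
  ring

/-- If `x` and `x'` agree on `t + 1` letters, their inflations with the same noise agree on at least
`t + l` positions, with `l` the length of the first block. The `i`-th shift still agrees on `t + (l
- i)` positions, and summing gives at most `q ^ (t + 1) / (1 - q)`, independently of `l`. -/
theorem VariationLE.dual (P : ProbabilityChoice ϑ) {lam C q : ℝ} (hlam : 0 < lam)
    (hC : 0 ≤ C) (hq0 : 0 ≤ q) (hq1 : q < 1) {f : C(ℤ → A, ℝ)} (hf : VariationLE f C q) :
    VariationLE (P.dual lam f) (C * (lam * (1 - q))⁻¹) q := by
  intro t ht x x' hx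
  obtain ⟨t, rfl⟩ := Nat.exists_eq_succ_of_ne_zero ht
  rw [P.dual_apply, P.dual_apply, ← mul_sub,
    ← integral_sub (P.integrable_blockSum f x) (P.integrable_blockSum f x')]
  refine abs_integral_noise_le P hlam hC hq0 hq1 (l := inflateLength x) fun ω => ?_
  have h0 : x 0 = x' 0 := by simpa using hx 0 (by omega)
  rw [blockSum, blockSum, ← inflateLength_congr h0, ← Finset.sum_sub_distrib]
  refine (Finset.abs_sum_le_sum_abs _ _).trans (Finset.sum_le_sum fun i hi => ?_)
  have hi := Finset.mem_range.1 hi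
  refine hf _ (by omega) _ _ fun k hk => ?_
  have := inflate_congr_of_lt (ω := ω) hx (n := k + i)
    (lt_of_lt_of_le (by push_cast; omega) (add_inflateLength_le_blockStart x ω t))
  simpa [shift] using this

/-- The same count as in `VariationLE.dual`, with legality of the initial window, which inflation
preserves, in place of agreement. -/
theorem LegalLE.dual [DecidableEq A] (P : ProbabilityChoice ϑ) {lam C q : ℝ} (hlam : 0 < lam)
    (hC : 0 ≤ C) (hq0 : 0 ≤ q) (hq1 : q < 1) {f : C(ℤ → A, ℝ)} (hf : LegalLE ϑ f C q) :
    LegalLE ϑ (P.dual lam f) (C * (lam * (1 - q))⁻¹) q := by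
  intro t ht x hx
  obtain ⟨t, rfl⟩ := Nat.exists_eq_succ_of_ne_zero ht
  rw [P.dual_apply]
  refine abs_integral_noise_le P hlam hC hq0 hq1 (l := inflateLength x) fun ω => ?_
  refine (Finset.abs_sum_le_sum_abs _ _).trans (Finset.sum_le_sum fun i hi => ?_)
  have hi := Finset.mem_range.1 hi
  refine hf _ (by omega) _ ?_
  rw [window_shift]
  refine (isConcat_inflate x ω).window_mem_language (inflateWord_mem x ω) hx (by omega)
    (by simp) ?_
  refine le_trans (by push_cast; omega)
    ((add_inflateLength_le_blockStart x ω t).trans_eq (by simp))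

end Contraction

/-! ### Iterates of the dual operators -/

section Pullback

variable {A : Type*} [TopologicalSpace A] [DiscreteTopology A] [Fintype A]
  {ϑ : RandomSubstitution A}

/-- The composition of the dual operators of `P n, …, P (n + k - 1)`, with `P n` applied first. -/
def pullback (P : ℕ → ProbabilityChoice ϑ) (lam : ℝ) (n : ℕ) :
    ℕ → C(ℤ → A, ℝ) →ₗ[ℝ] C(ℤ → A, ℝ)
  | 0 => LinearMap.id
  | k + 1 => ((P (n + k)).dual lam).comp (pullback P lam n k)

variable (P : ℕ → ProbabilityChoice ϑ) {lam : ℝ} (n : ℕ)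

@[simp]
theorem pullback_zero (f : C(ℤ → A, ℝ)) : pullback P lam n 0 f = f := rfl

theorem pullback_succ (k : ℕ) (f : C(ℤ → A, ℝ)) :
    pullback P lam n (k + 1) f = (P (n + k)).dual lam (pullback P lam n k f) := rfl

theorem pullback_succ_eq_pullback_dual (k : ℕ) (f : C(ℤ → A, ℝ)) :
    pullback P lam n (k + 1) f = pullback P lam (n + 1) k ((P n).dual lam f) := by
  induction k with
  | zero => rfl
  | succ k ih => rw [pullback_succ, ih, pullback_succ, add_right_comm, add_assoc]

theorem pullback_mono (hlam : 0 ≤ lam) (k : ℕ) {f g : C(ℤ → A, ℝ)} (h : f ≤ g) :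
    pullback P lam n k f ≤ pullback P lam n k g := by
  induction k with
  | zero => exact h
  | succ k ih => exact (P (n + k)).dual_mono hlam ih

theorem VariationLE.pullback (hlam : 0 < lam) {C q : ℝ} (hC : 0 ≤ C) (hq0 : 0 ≤ q)
    (hq1 : q < 1) {f : C(ℤ → A, ℝ)} (hf : VariationLE f C q) (k : ℕ) :
    VariationLE (pullback P lam n k f) (C * (lam * (1 - q))⁻¹ ^ k) q := by
  have hs : 0 ≤ (lam * (1 - q))⁻¹ := inv_nonneg.2 (mul_nonneg hlam.le (by linarith))
  induction k with
  | zero => simpa using hf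
  | succ k ih =>
    rw [pow_succ, ← mul_assoc]
    exact ih.dual _ hlam (by positivity) hq0 hq1

theorem LegalLE.pullback [DecidableEq A] (hlam : 0 < lam) {C q : ℝ} (hC : 0 ≤ C) (hq0 : 0 ≤ q)
    (hq1 : q < 1) {f : C(ℤ → A, ℝ)} (hf : LegalLE ϑ f C q) (k : ℕ) :
    LegalLE ϑ (pullback P lam n k f) (C * (lam * (1 - q))⁻¹ ^ k) q := by
  have hs : 0 ≤ (lam * (1 - q))⁻¹ := inv_nonneg.2 (mul_nonneg hlam.le (by linarith))
  induction k with
  | zero => simpa using hf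
  | succ k ih =>
    rw [pow_succ, ← mul_assoc]
    exact ih.dual _ hlam (by positivity) hq0 hq1

theorem exists_pullback_shiftComp_sub (k : ℕ) (f : C(ℤ → A, ℝ)) :
    ∃ g : C(ℤ → A, ℝ), ‖g‖ ≤ ‖f‖ ∧
      pullback P lam n k (shiftComp f - f) = lam⁻¹ ^ k • (shiftComp g - g) := by
  induction k with
  | zero => exact ⟨f, le_rfl, by simp⟩
  | succ k ih =>
    obtain ⟨g, h1, h2⟩ := ih
    refine ⟨(P (n + k)).expectation g, ((P (n + k)).norm_expectation_le g).trans h1, ?_⟩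
    rw [pullback_succ, h2, map_smul, (P (n + k)).dual_shiftComp_sub, smul_smul, pow_succ]

variable [DecidableEq A] {L : A → ℝ}

theorem pullback_letterFun_length (h : ϑ.GeometricallyCompatible lam L) (k : ℕ) :
    pullback P lam n k (letterFun L) = letterFun L := by
  induction k with
  | zero => rfl
  | succ k ih => rw [pullback_succ, ih, (P (n + k)).dual_letterFun_length h]

theorem pullback_letterFun_single (h : ϑ.GeometricallyCompatible lam L) (k : ℕ) (b : A) :
    pullback P lam n k (letterFun (Pi.single b (L b))) =
      ∑ a, ((List.range k).map fun i => (P (n + i)).geometricMatrix lam L).prod b a •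
        letterFun (Pi.single a (L a)) := by
  induction k with
  | zero => simp [Matrix.one_apply]
  | succ k ih =>
    rw [pullback_succ, ih, map_sum]
    simp only [map_smul, (P (n + k)).dual_letterFun_single h, Finset.smul_sum, smul_smul,
      List.range_succ, List.map_append, List.map_cons, List.map_nil, List.prod_append,
      List.prod_singleton, Matrix.mul_apply, Finset.sum_smul]
    exact Finset.sum_comm

/-- The dual operators are positive and fix the length function, so `f` can be squeezed between
multiples `±(‖f‖ / m)` of it. -/
theorem abs_pullback_le (h : ϑ.GeometricallyCompatible lam L) {m : ℝ} (hm : 0 < m)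
    (hmL : ∀ a, m ≤ L a) (k : ℕ) (f : C(ℤ → A, ℝ)) (x : ℤ → A) :
    |pullback P lam n k f x| ≤ ‖f‖ / m * L (x 0) := by
  have hlam : 0 ≤ lam := (zero_lt_one.trans h.one_lt).le
  have hle (y : ℤ → A) : |f y| ≤ ‖f‖ / m * L (y 0) := by
    rw [div_mul_eq_mul_div, le_div_iff₀ hm]
    exact mul_le_mul (f.norm_coe_le_norm y) (hmL _) hm.le (norm_nonneg f)
  have e : pullback P lam n k ((‖f‖ / m) • letterFun L) = (‖f‖ / m) • letterFun L := by
    rw [map_smul, pullback_letterFun_length P n h]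
  have h1 := pullback_mono P n hlam k (f := f) (g := (‖f‖ / m) • letterFun L)
    fun y => (abs_le.1 (hle y)).2
  have h2 := pullback_mono P n hlam k (f := -((‖f‖ / m) • letterFun L)) (g := f)
    fun y => (abs_le.1 (hle y)).1
  rw [map_neg, e] at h2
  rw [e] at h1
  exact abs_le.2 ⟨h2 x, h1 x⟩

end Pullback

/-! ### Normalised functionals and uniqueness -/

section Normalized

variable {A : Type*} [MeasurableSpace A]

/-- Integration against `μ`, normalised to be `1` on the length of the letter at the origin. -/
def normalized [TopologicalSpace A] (L : A → ℝ) (μ : Measure (ℤ → A)) (f : C(ℤ → A, ℝ)) : ℝ :=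
  (∫ x, L (x 0) ∂μ)⁻¹ * ∫ x, f x ∂μ

theorem exists_pos_forall_le [Finite A] {L : A → ℝ} (hL : ∀ a, 0 < L a) :
    ∃ m, 0 < m ∧ ∀ a, m ≤ L a := by
  cases isEmpty_or_nonempty A
  · exact ⟨1, one_pos, isEmptyElim⟩
  · obtain ⟨a, ha⟩ := Finite.exists_min L
    exact ⟨L a, hL a, ha⟩

variable [TopologicalSpace A] [DiscreteTopology A] [Fintype A] [DiscreteMeasurableSpace A]
  {L : A → ℝ} {μ : Measure (ℤ → A)} {ϑ : RandomSubstitution A}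

theorem integrable_continuousMap [IsFiniteMeasure μ] (f : C(ℤ → A, ℝ)) : Integrable f μ :=
  ProbabilityChoice.integrable_of_continuous f.continuous

theorem le_integral_length [IsProbabilityMeasure μ] {m : ℝ} (hm : ∀ a, m ≤ L a) :
    m ≤ ∫ x, L (x 0) ∂μ := by
  have := integral_mono (μ := μ) (f := fun _ => m) (integrable_const m)
    (integrable_continuousMap (letterFun L)) fun x => hm (x 0)
  simpa using this

theorem abs_normalized_le [IsProbabilityMeasure μ] {m c : ℝ} (hm0 : 0 < m) (hm : ∀ a, m ≤ L a)
    {f : C(ℤ → A, ℝ)} (hf : ∀ x, |f x| ≤ c) : |normalized L μ f| ≤ m⁻¹ * c := by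
  have h1 := le_integral_length (μ := μ) hm
  have h2 : |∫ x, f x ∂μ| ≤ c := by
    simpa using norm_integral_le_of_norm_le_const (μ := μ) (f := f) (.of_forall hf)
  rw [normalized, abs_mul, abs_of_nonneg (inv_nonneg.2 (hm0.le.trans h1))]
  exact mul_le_mul (inv_anti₀ hm0 h1) h2 (abs_nonneg _) (by positivity)

theorem normalized_sub [IsFiniteMeasure μ] (f g : C(ℤ → A, ℝ)) :
    normalized L μ (f - g) = normalized L μ f - normalized L μ g := by
  simp only [normalized, ContinuousMap.sub_apply]
  rw [integral_sub (integrable_continuousMap f) (integrable_continuousMap g), mul_sub]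

theorem normalized_sum_smul [IsFiniteMeasure μ] {ι : Type*} (s : Finset ι) (c : ι → ℝ)
    (f : ι → C(ℤ → A, ℝ)) :
    normalized L μ (∑ i ∈ s, c i • f i) = ∑ i ∈ s, c i * normalized L μ (f i) := by
  simp only [normalized, ContinuousMap.sum_apply, ContinuousMap.smul_apply, smul_eq_mul]
  rw [integral_finsetSum _ fun i _ => (integrable_continuousMap (f i)).const_mul (c i),
    Finset.mul_sum]
  refine Finset.sum_congr rfl fun i _ => ?_
  rw [integral_const_mul, mul_left_comm]

theorem normalized_smul_measure {c : ℝ≥0∞} (hc0 : c ≠ 0) (hc : c ≠ ⊤) (f : C(ℤ → A, ℝ)) :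
    normalized L (c • μ) f = normalized L μ f := by
  have : c.toReal ≠ 0 := ENNReal.toReal_ne_zero.2 ⟨hc0, hc⟩
  simp only [normalized, integral_smul_measure, smul_eq_mul]
  field_simp

theorem letterFun_eq_sum [DecidableEq A] (hL : ∀ a, 0 < L a) (g : A → ℝ) :
    letterFun g = ∑ a, (g a / L a) • letterFun (Pi.single a (L a)) := by
  ext x
  rw [ContinuousMap.sum_apply, Finset.sum_eq_single (x 0)]
  · have := (hL (x 0)).ne'
    simp
    field_simp
  · intro c _ hc
    simp [hc.symm]
  · simp

variable [DecidableEq A] {lam : ℝ}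

theorem ProbabilityChoice.integral_transfer_eq_dual (P : ProbabilityChoice ϑ) (hlam : lam ≠ 0)
    (hrec : ϑ.IsRecognisable) [IsProbabilityMeasure μ] (hμ : μ ϑ.subshiftᶜ = 0)
    (f : C(ℤ → A, ℝ)) :
    ∫ x, f x ∂(P.transfer μ) =
      (P.transferNorm μ).toReal⁻¹ * lam * ∫ x, P.dual lam f x ∂μ := by
  rw [P.integral_transfer hrec hμ f.continuous]
  simp only [P.dual_apply, integral_const_mul]
  field_simp

/-- The length function is fixed by the dual, so its integral picks up the same factor `lam /
transferNorm` as that of `f`, and the factor cancels. -/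
theorem ProbabilityChoice.normalized_transfer (P : ProbabilityChoice ϑ)
    (hgeom : ϑ.GeometricallyCompatible lam L) (hrec : ϑ.IsRecognisable) [IsProbabilityMeasure μ]
    (hμ : μ ϑ.subshiftᶜ = 0) (f : C(ℤ → A, ℝ)) :
    normalized L (P.transfer μ) f = normalized L μ (P.dual lam f) := by
  have hlam : lam ≠ 0 := (zero_lt_one.trans hgeom.one_lt).ne'
  have hN : (P.transferNorm μ).toReal ≠ 0 := ENNReal.toReal_ne_zero.2
    ⟨(zero_lt_one.trans_le (P.one_le_transferNorm hrec hμ)).ne', P.transferNorm_ne_top hrec hμ⟩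
  have hlen : ∫ x, L (x 0) ∂(P.transfer μ) =
      (P.transferNorm μ).toReal⁻¹ * lam * ∫ x, L (x 0) ∂μ := by
    have := P.integral_transfer_eq_dual hlam hrec hμ (letterFun L)
    rw [P.dual_letterFun_length hgeom] at this
    exact this
  rw [normalized, normalized, P.integral_transfer_eq_dual hlam hrec hμ f, hlen]
  field_simp

variable {P : ℕ → ProbabilityChoice ϑ} {ν ν' : ℕ → Measure (ℤ → A)}

theorem IsAdapted.normalized_eq (hgeom : ϑ.GeometricallyCompatible lam L)
    (hrec : ϑ.IsRecognisable) (hν : IsAdapted P ν) (n k : ℕ) (f : C(ℤ → A, ℝ)) :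
    normalized L (ν n) f = normalized L (ν (n + k)) (pullback P lam n k f) := by
  induction k with
  | zero => rfl
  | succ k ih =>
    have := (hν.1 (n + k + 1)).1
    rw [ih, hν.2 (n + k), (P (n + k)).normalized_transfer hgeom hrec (hν.1 (n + k + 1)).2.2]
    rfl

/-- The relative length of the letter `b` with respect to `μ`. -/
def letterWeight (L : A → ℝ) (μ : Measure (ℤ → A)) (b : A) : ℝ :=
  normalized L μ (letterFun (Pi.single b (L b)))

theorem letterWeight_nonneg [IsProbabilityMeasure μ] (hL : ∀ a, 0 < L a) (b : A) :
    0 ≤ letterWeight L μ b := by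
  refine mul_nonneg (inv_nonneg.2 (integral_nonneg fun x => (hL _).le))
    (integral_nonneg fun x => ?_)
  simp only [letterFun_apply, Pi.single_apply]
  split_ifs
  · exact (hL b).le
  · exact le_rfl

theorem normalized_letterFun_length [IsProbabilityMeasure μ] (hL : ∀ a, 0 < L a) :
    normalized L μ (letterFun L) = 1 := by
  obtain ⟨m, hm0, hm⟩ := exists_pos_forall_le hL
  exact inv_mul_cancel₀ (hm0.trans_le (le_integral_length (μ := μ) hm)).ne'

theorem normalized_letterFun [IsFiniteMeasure μ] (hL : ∀ a, 0 < L a) (g : A → ℝ) :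
    normalized L μ (letterFun g) = ∑ a, g a / L a * letterWeight L μ a := by
  rw [letterFun_eq_sum hL g, normalized_sum_smul]
  rfl

theorem sum_letterWeight [IsProbabilityMeasure μ] (hL : ∀ a, 0 < L a) :
    ∑ b, letterWeight L μ b = 1 := by
  rw [← normalized_letterFun_length (μ := μ) hL, normalized_letterFun hL]
  simp [div_self (hL _).ne']

theorem IsAdapted.letterWeight_eq (hgeom : ϑ.GeometricallyCompatible lam L)
    (hrec : ϑ.IsRecognisable) (hν : IsAdapted P ν) (n k : ℕ) (b : A) :
    letterWeight L (ν n) b =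
      ∑ a, ((List.range k).map fun i => (P (n + i)).geometricMatrix lam L).prod b a *
        letterWeight L (ν (n + k)) a := by
  have := (hν.1 (n + k)).1
  rw [letterWeight, hν.normalized_eq hgeom hrec n k, pullback_letterFun_single P n hgeom,
    normalized_sum_smul]
  rfl

/-- The weights at level `n` are a matrix product applied to the weights at a far level. These form
an unknown probability vector, but a product close to `p 𝟙ᵀ` sends every probability vector close to
`p`. -/
theorem IsAdapted.letterWeight_eq_of_tendsto (hgeom : ϑ.GeometricallyCompatible lam L)
    (hrec : ϑ.IsRecognisable) (hν : IsAdapted P ν) {n : ℕ} {p : A → ℝ}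
    (hp : Tendsto (fun k : ℕ => ((List.range (k + 1)).map fun i =>
      (P (n + i)).geometricMatrix lam L).prod) atTop (𝓝 (Matrix.vecMulVec p 1))) :
    letterWeight L (ν n) = p := by
  funext b
  set M : ℕ → Matrix A A ℝ := fun k => ((List.range (k + 1)).map fun i =>
    (P (n + i)).geometricMatrix lam L).prod with hM
  have hentry (a : A) : Tendsto (fun k => M k b a) atTop (𝓝 (p b)) := by
    have := tendsto_pi_nhds.1 (tendsto_pi_nhds.1 hp b) a
    simpa [Matrix.vecMulVec_apply] using this
  have hbound (k : ℕ) : |letterWeight L (ν n) b - p b| ≤ ∑ a, |M k b a - p b| := by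
    have := (hν.1 (n + (k + 1))).1
    have e : letterWeight L (ν n) b - p b =
        ∑ a, (M k b a - p b) * letterWeight L (ν (n + (k + 1))) a := by
      simp only [sub_mul, Finset.sum_sub_distrib]
      rw [← Finset.mul_sum, sum_letterWeight hgeom.pos, mul_one,
        hν.letterWeight_eq hgeom hrec n (k + 1)]
    rw [e]
    refine (Finset.abs_sum_le_sum_abs _ _).trans (Finset.sum_le_sum fun a _ => ?_)
    rw [abs_mul, abs_of_nonneg (letterWeight_nonneg hgeom.pos a)]
    refine mul_le_of_le_one_right (abs_nonneg _) ?_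
    rw [← sum_letterWeight (μ := ν (n + (k + 1))) hgeom.pos]
    exact Finset.single_le_sum (fun a _ => letterWeight_nonneg hgeom.pos a) (Finset.mem_univ a)
  have hlim : Tendsto (fun k => ∑ a, |M k b a - p b|) atTop (𝓝 0) := by
    have := tendsto_finsetSum (Finset.univ : Finset A)
      fun a _ => ((hentry a).sub_const (p b)).abs
    simpa using this
  have := ge_of_tendsto' hlim hbound
  exact sub_eq_zero.1 (abs_nonpos_iff.1 this)

theorem exists_contraction_rate (hlam : 1 < lam) :
    ∃ q : ℝ, 0 < q ∧ q < 1 ∧ 0 ≤ (lam * (1 - q))⁻¹ ∧ (lam * (1 - q))⁻¹ < 1 := by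
  have h0 : 0 < lam := by linarith
  have e : lam * (1 - (lam - 1) / (2 * lam)) = (lam + 1) / 2 := by
    field_simp
    ring
  -- Any `q` in `(0, 1 - 1/lam)` works; this is the midpoint, for which `lam * (1 - q) = (lam + 1) /
  -- 2`.
  refine ⟨(lam - 1) / (2 * lam), div_pos (by linarith) (by linarith),
    (div_lt_one (by linarith)).2 (by linarith), ?_, ?_⟩
  · rw [e]
    exact inv_nonneg.2 (by linarith)
  · rw [e]
    exact inv_lt_one_of_one_lt₀ (by linarith)

/-- After `k` steps the pulled-back function is within `C * s ^ k * q` of a function of the letter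
at the origin, and on those the two functionals agree by assumption. -/
theorem IsAdapted.normalized_eq_of_letterWeight_eq (hgeom : ϑ.GeometricallyCompatible lam L)
    (hrec : ϑ.IsRecognisable) (hν : IsAdapted P ν) (hν' : IsAdapted P ν')
    (h : ∀ n, letterWeight L (ν n) = letterWeight L (ν' n)) {C q : ℝ} (hC : 0 ≤ C)
    (hq0 : 0 < q) (hq1 : q < 1) (hs0 : 0 ≤ (lam * (1 - q))⁻¹) (hs1 : (lam * (1 - q))⁻¹ < 1)
    {f : C(ℤ → A, ℝ)} (hf : VariationLE f C q) :
    normalized L (ν 0) f = normalized L (ν' 0) f := by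
  obtain ⟨m, hm0, hm⟩ := exists_pos_forall_le hgeom.pos
  set s := (lam * (1 - q))⁻¹ with hs
  have hbound (k : ℕ) : |normalized L (ν 0) f - normalized L (ν' 0) f| ≤
      2 * (m⁻¹ * (C * q)) * s ^ k := by
    have := (hν.1 (0 + k)).1
    have := (hν'.1 (0 + k)).1
    rw [hν.normalized_eq hgeom hrec 0 k, hν'.normalized_eq hgeom hrec 0 k]
    set F := pullback P lam 0 k f
    have hF : VariationLE F (C * s ^ k) q :=
      hf.pullback P 0 (zero_lt_one.trans hgeom.one_lt) hC hq0.le hq1 k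
    -- The constant sequences need not lie in the subshift; `VariationLE` controls `F` on all
    -- sequences.
    set G : C(ℤ → A, ℝ) := letterFun fun a => F fun _ => a
    have hFG (x : ℤ → A) : |(F - G) x| ≤ C * s ^ k * q := by
      have := hF 1 one_ne_zero x (fun _ => x 0) fun k hk => by simp [Nat.lt_one_iff.1 hk]
      rwa [pow_one] at this
    have hG : normalized L (ν (0 + k)) G = normalized L (ν' (0 + k)) G := by
      rw [normalized_letterFun hgeom.pos, normalized_letterFun hgeom.pos, h]
    have h1 := abs_normalized_le (μ := ν (0 + k)) hm0 hm hFG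
    have h2 := abs_normalized_le (μ := ν' (0 + k)) hm0 hm hFG
    rw [normalized_sub] at h1 h2
    rw [hG] at h1
    rw [abs_le] at h1 h2 ⊢
    constructor <;> linarith [h1.1, h1.2, h2.1, h2.2]
  have hlim : Tendsto (fun k => 2 * (m⁻¹ * (C * q)) * s ^ k) atTop (𝓝 0) := by
    simpa using (tendsto_pow_atTop_nhds_zero_of_lt_one hs0 hs1).const_mul (2 * (m⁻¹ * (C * q)))
  exact sub_eq_zero.1 (abs_nonpos_iff.1 (ge_of_tendsto' hlim hbound))

theorem measurePreserving_shift_natCast (h : MeasurePreserving (shift 1) μ μ) (N : ℕ) :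
    MeasurePreserving (shift (N : ℤ)) μ μ := by
  induction N with
  | zero =>
    rw [show shift ((0 : ℕ) : ℤ) = (id : (ℤ → A) → ℤ → A) from funext shift_zero]
    exact MeasurePreserving.id μ
  | succ N ih =>
    have := h.comp ih
    convert! this using 1
    funext x
    rw [Function.comp_apply, shift_shift]
    push_cast
    rw [add_comm]

/-- The indicator function of a clopen set, as a continuous function. -/
def clopenIndicator {X : Type*} [TopologicalSpace X] {S : Set X} (hS : IsClopen S) : C(X, ℝ) :=
  ⟨S.indicator 1, (continuous_const (y := (1 : ℝ))).indicator (by simp [hS.frontier_eq])⟩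

theorem clopenIndicator_of_mem {X : Type*} [TopologicalSpace X] {S : Set X} (hS : IsClopen S)
    {x : X} (hx : x ∈ S) : clopenIndicator hS x = 1 :=
  Set.indicator_of_mem hx 1

theorem clopenIndicator_of_notMem {X : Type*} [TopologicalSpace X] {S : Set X} (hS : IsClopen S)
    {x : X} (hx : x ∉ S) : clopenIndicator hS x = 0 :=
  Set.indicator_of_notMem hx 1

theorem integral_clopenIndicator {X : Type*} [TopologicalSpace X] [MeasurableSpace X]
    [OpensMeasurableSpace X] {S : Set X} (hS : IsClopen S) (ρ : Measure X) :
    ∫ x, clopenIndicator hS x ∂ρ = ρ.real S :=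
  integral_indicator_one hS.1.measurableSet

/-- Adapted sequences are determined by their letter weights. -/
theorem IsAdapted.eq_of_letterWeight_eq (hgeom : ϑ.GeometricallyCompatible lam L)
    (hrec : ϑ.IsRecognisable) (hν : IsAdapted P ν) (hν' : IsAdapted P ν')
    (h : ∀ n, letterWeight L (ν n) = letterWeight L (ν' n)) : ν 0 = ν' 0 := by
  obtain ⟨q, hq0, hq1, hs0, hs1⟩ := exists_contraction_rate hgeom.one_lt
  obtain ⟨m, hm0, hm⟩ := exists_pos_forall_le hgeom.pos
  have := (hν.1 0).1
  have := (hν'.1 0).1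
  have key {C : ℝ} (hC : 0 ≤ C) {f : C(ℤ → A, ℝ)} (hf : VariationLE f C q) :=
    hν.normalized_eq_of_letterWeight_eq hgeom hrec hν' h hC hq0 hq1 hs0 hs1 hf
  -- Testing with the constant function `1` recovers the mean length lost in the normalisation.
  have hlen : (∫ x, L (x 0) ∂ν 0)⁻¹ = (∫ x, L (x 0) ∂ν' 0)⁻¹ := by
    have := key (f := 1) le_rfl fun t _ x x' _ => by simp
    simpa [normalized] using this
  have hlen0 : (∫ x, L (x 0) ∂ν' 0)⁻¹ ≠ 0 :=
    inv_ne_zero (hm0.trans_le (le_integral_length (μ := ν' 0) hm)).ne'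
  have hint {C : ℝ} (hC : 0 ≤ C) {f : C(ℤ → A, ℝ)} (hf : VariationLE f C q) :
      ∫ x, f x ∂ν 0 = ∫ x, f x ∂ν' 0 := by
    have := key hC hf
    rw [normalized, normalized, hlen] at this
    exact mul_left_cancel₀ hlen0 this
  refine ext_of_generate_finite _ (generateFrom_squareCylinders (α := fun _ : ℤ => A)).symm
    (isPiSystem_squareCylinders (fun _ => MeasurableSpace.isPiSystem_measurableSet)
      fun _ => by simp) ?_ (by simp)
  rintro _ ⟨s, t, -, rfl⟩
  obtain ⟨N, hN⟩ : ∃ N : ℕ, ∀ i ∈ s, i.natAbs ≤ N :=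
    ⟨s.sup Int.natAbs, fun i hi => Finset.le_sup (f := Int.natAbs) hi⟩
  have hclosed : IsClopen ((s : Set ℤ).pi t) := by
    have : ((s : Set ℤ).pi t) = ⋂ i ∈ s, (fun x : ℤ → A => x i) ⁻¹' t i := by
      ext x
      simp
    rw [this]
    exact s.finite_toSet.isClopen_biInter fun i _ =>
      (isClopen_discrete (t i)).preimage (continuous_apply i)
  -- `VariationLE` sees only coordinates `≥ 0`, so the cylinder is first moved into `[0, 2N]`;
  -- invariance undoes the shift at the end.
  have hclopen : IsClopen (shift (N : ℤ) ⁻¹' ((s : Set ℤ).pi t)) :=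
    hclosed.preimage (continuous_shift _)
  -- The constant makes the bound at least `1` while `l ≤ 2N`; for larger `l` the two values
  -- coincide.
  have hf : VariationLE (clopenIndicator hclopen) (q ^ (2 * N + 1))⁻¹ q := by
    intro l _ x x' hx
    by_cases hl : l ≤ 2 * N
    · have h1 : |clopenIndicator hclopen x - clopenIndicator hclopen x'| ≤ 1 := by
        by_cases h1 : x ∈ shift (N : ℤ) ⁻¹' ((s : Set ℤ).pi t) <;>
        by_cases h2 : x' ∈ shift (N : ℤ) ⁻¹' ((s : Set ℤ).pi t) <;>
        simp [clopenIndicator_of_mem, clopenIndicator_of_notMem, h1, h2]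
      refine h1.trans ?_
      rw [inv_mul_eq_div, one_le_div (by positivity)]
      exact pow_le_pow_of_le_one hq0.le hq1.le (by omega)
    · have hiff : x ∈ shift (N : ℤ) ⁻¹' ((s : Set ℤ).pi t) ↔
          x' ∈ shift (N : ℤ) ⁻¹' ((s : Set ℤ).pi t) := by
        simp only [Set.mem_preimage, Set.mem_pi, Finset.mem_coe, shift]
        refine forall₂_congr fun i hi => ?_
        have := hx (i + N).toNat (by have := hN i hi; omega)
        rw [Int.toNat_of_nonneg (by have := hN i hi; omega)] at this
        rw [this]
      have : clopenIndicator hclopen x = clopenIndicator hclopen x' := by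
        by_cases h1 : x ∈ shift (N : ℤ) ⁻¹' ((s : Set ℤ).pi t)
        · rw [clopenIndicator_of_mem _ h1, clopenIndicator_of_mem _ (hiff.1 h1)]
        · rw [clopenIndicator_of_notMem _ h1, clopenIndicator_of_notMem _ fun h => h1 (hiff.2 h)]
      rw [this, sub_self, abs_zero]
      positivity
  have := hint (by positivity) hf
  rwa [integral_clopenIndicator, integral_clopenIndicator, measureReal_def, measureReal_def,
    ENNReal.toReal_eq_toReal_iff' (by simp) (by simp),
    (measurePreserving_shift_natCast (hν.1 0).2.1 N).measure_preimage
      hclosed.1.measurableSet.nullMeasurableSet,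
    (measurePreserving_shift_natCast (hν'.1 0).2.1 N).measure_preimage
      hclosed.1.measurableSet.nullMeasurableSet] at this

/-- An adapted sequence is determined by its first member. -/
theorem IsAdapted.eq_of_eq_zero (hrec : ϑ.IsRecognisable) (hν : IsAdapted P ν)
    (hν' : IsAdapted P ν') (h : ν 0 = ν' 0) : ν = ν' := by
  funext n
  induction n with
  | zero => exact h
  | succ n ih =>
    have := (hν.1 (n + 1)).1
    have := (hν'.1 (n + 1)).1
    exact (P n).transfer_injective hrec (hν.1 (n + 1)).2.2 (hν'.1 (n + 1)).2.2
      (by rw [← hν.2 n, ← hν'.2 n, ih])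

end Normalized

/-! ### Existence of adapted sequences -/

theorem exists_measure_integral_eq {X : Type*} [TopologicalSpace X] [T2Space X] [CompactSpace X]
    [MeasurableSpace X] [BorelSpace X] (Λ : C(X, ℝ) → ℝ)
    (hadd : ∀ f g, Λ (f + g) = Λ f + Λ g) (hsmul : ∀ (c : ℝ) f, Λ (c • f) = c * Λ f)
    (hpos : ∀ f, 0 ≤ f → 0 ≤ Λ f) :
    ∃ μ : Measure X, IsFiniteMeasure μ ∧ ∀ f : C(X, ℝ), ∫ x, f x ∂μ = Λ f := by
  have hmono {f g : C(X, ℝ)} (h : f ≤ g) : Λ f ≤ Λ g := by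
    have h1 := hpos (g - f) (sub_nonneg.2 h)
    have h2 := hadd f (g - f)
    rw [add_sub_cancel] at h2
    linarith
  let Λ' : CompactlySupportedContinuousMap X ℝ →ₚ[ℝ] ℝ :=
  { toFun g := Λ g.toContinuousMap
    map_add' f g := hadd f.toContinuousMap g.toContinuousMap
    map_smul' c g := hsmul c g.toContinuousMap
    monotone' f g h := hmono h }
  refine ⟨RealRMK.rieszMeasure Λ', inferInstance, fun f => ?_⟩
  exact RealRMK.integral_rieszMeasure Λ' ⟨f, HasCompactSupport.of_compactSpace f⟩

section Existence

variable {A : Type*} [MeasurableSpace A] [TopologicalSpace A] [DiscreteTopology A] [Fintype A]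
  [DiscreteMeasurableSpace A] {L : A → ℝ} {μ μ' : Measure (ℤ → A)} {ϑ : RandomSubstitution A}

theorem eq_of_normalized_eq (hL : ∀ a, 0 < L a) [IsProbabilityMeasure μ]
    [IsProbabilityMeasure μ'] (h : ∀ f, normalized L μ f = normalized L μ' f) : μ = μ' := by
  obtain ⟨m, hm0, hm⟩ := exists_pos_forall_le hL
  have hlen : (∫ x, L (x 0) ∂μ)⁻¹ = (∫ x, L (x 0) ∂μ')⁻¹ := by
    simpa [normalized] using h 1
  refine ext_of_forall_integral_eq_of_IsFiniteMeasure fun f => ?_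
  have := h f.toContinuousMap
  rw [normalized, normalized, hlen] at this
  exact mul_left_cancel₀ (inv_ne_zero (hm0.trans_le (le_integral_length (μ := μ') hm)).ne') this

variable [DecidableEq A] {lam : ℝ}

/-- The block sum of the constant `1` is the block length, whose mean is `transferNorm`. -/
theorem ProbabilityChoice.isProbabilityMeasure_transfer (P : ProbabilityChoice ϑ)
    (hrec : ϑ.IsRecognisable) [IsProbabilityMeasure μ] (hμ : μ ϑ.subshiftᶜ = 0) :
    IsProbabilityMeasure (P.transfer μ) := by
  have hN0 := (zero_lt_one.trans_le (P.one_le_transferNorm hrec hμ)).ne'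
  have hN := P.transferNorm_ne_top hrec hμ
  have hfin : IsFiniteMeasure (P.transfer μ) := by
    rw [P.transfer_eq hrec hμ]
    exact Measure.smul_finite _ (ENNReal.inv_ne_top.2 hN0)
  have h := P.integral_transfer hrec hμ (f := fun _ => 1) continuous_const
  have hlen : ∫ x, ∫ ω, blockSum (fun _ => (1 : ℝ)) x ω ∂P.noise ∂μ =
      (P.transferNorm μ).toReal := by
    rw [← integral_prod (fun p : (ℤ → A) × (ℤ → Marginal ϑ) => blockSum (fun _ => (1 : ℝ)) p.1 p.2)
      (integrable_of_continuous (continuous_blockSum continuous_const)),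
      P.transferNorm_eq hrec hμ, ← integral_toReal]
    · simp [blockSum]
    · exact ((Measurable.of_discrete (f := fun n : ℕ => (n : ℝ≥0∞))).comp
        measurable_inflateLength).aemeasurable
    · exact .of_forall fun p => ENNReal.natCast_lt_top _
  rw [hlen, inv_mul_cancel₀ (ENNReal.toReal_ne_zero.2 ⟨hN0, hN⟩)] at h
  refine ⟨(ENNReal.toReal_eq_one_iff _).1 ?_⟩
  simpa [measureReal_def] using h

theorem legalLE_clopenIndicator (ϑ : RandomSubstitution A) {N : ℕ} (hN : N ≠ 0) {q : ℝ}
    (hq0 : 0 < q) (hq1 : q < 1) :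
    LegalLE ϑ (clopenIndicator (isClopen_window_mem 0 N ϑ.languageᶜ)) (q ^ N)⁻¹ q := by
  intro t _ x hx
  by_cases hNt : N ≤ t
  · have : window x 0 N ∈ ϑ.language :=
      RandomSubstitution.mem_language_of_infix hx
        (window_infix_window x le_rfl (by omega)) (by
          rw [← List.length_pos_iff, length_window]
          omega)
    have h : x ∉ {x : ℤ → A | window x 0 N ∈ ϑ.languageᶜ} := fun h => h this
    rw [clopenIndicator_of_notMem _ h, abs_zero]
    positivity
  · have h1 : |clopenIndicator (isClopen_window_mem 0 N ϑ.languageᶜ) x| ≤ 1 := by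
      by_cases h : x ∈ {x : ℤ → A | window x 0 N ∈ ϑ.languageᶜ}
      · simp [clopenIndicator_of_mem _ h]
      · simp [clopenIndicator_of_notMem _ h]
    refine h1.trans ?_
    rw [inv_mul_eq_div, one_le_div (by positivity)]
    exact pow_le_pow_of_le_one hq0.le hq1.le (by omega)

/-- By invariance, windows at all positions carry the same law, and there are only countably many
windows. -/
theorem measure_compl_subshift_eq_zero (hμ : MeasurePreserving (shift 1) μ μ)
    (h : ∀ N : ℕ, N ≠ 0 → μ {x | window x 0 N ∈ ϑ.languageᶜ} = 0) : μ ϑ.subshiftᶜ = 0 := by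
  have hi (i : ℤ) (N : ℕ) (hN : N ≠ 0) : μ {x | window x i N ∈ ϑ.languageᶜ} = 0 := by
    have hm (i : ℤ) : NullMeasurableSet {x | window x i N ∈ ϑ.languageᶜ} μ :=
      (isClopen_window_mem i N ϑ.languageᶜ).1.measurableSet.nullMeasurableSet
    obtain ⟨k, rfl | rfl⟩ := i.eq_nat_or_neg
    · have := (measurePreserving_shift_natCast hμ k).measure_preimage (hm 0)
      rw [← h N hN, ← this]
      simp [Set.preimage, window_shift]
    · have := (measurePreserving_shift_natCast hμ k).measure_preimage (hm (-(k : ℤ)))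
      rw [← this]
      simpa [Set.preimage, window_shift] using h N hN
  have : ϑ.subshiftᶜ ⊆ ⋃ (i : ℤ) (N : ℕ) (_ : N ≠ 0), {x | window x i N ∈ ϑ.languageᶜ} := by
    intro x hx
    simp only [RandomSubstitution.subshift, Set.mem_compl_iff, Set.mem_ofPred_eq] at hx
    push Not at hx
    obtain ⟨i, N, hN, h⟩ := hx
    simp only [Set.mem_iUnion]
    exact ⟨i, N, by omega, h⟩
  refine measure_mono_null this ?_
  simp only [measure_iUnion_null_iff]
  exact hi

/-- The point mass at the constant sequence `a` is placed at level `K` and pulled down to every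
level `n`. The ultrafilter yields limits for all `n` and `f` at once. Limits are positive, hence
measures by Riesz. Invariance comes from contraction of coboundaries, and concentration on the
subshift from `LegalLE`, although the constant sequence need be neither legal nor typical. -/
theorem exists_isAdapted_tendsto (hgeom : ϑ.GeometricallyCompatible lam L)
    (hrec : ϑ.IsRecognisable) (P : ℕ → ProbabilityChoice ϑ) (a : A) (U : Ultrafilter ℕ)
    (hU : (U : Filter ℕ) ≤ atTop) :
    ∃ ν : ℕ → Measure (ℤ → A), IsAdapted P ν ∧ ∀ n f,
      Tendsto (fun K => pullback P lam n (K - n) f (fun _ => a) / L a) U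
        (𝓝 (normalized L (ν n) f)) := by
  obtain ⟨m, hm0, hm⟩ := exists_pos_forall_le hgeom.pos
  obtain ⟨q, hq0, hq1, hs0, hs1⟩ := exists_contraction_rate hgeom.one_lt
  have hlam : 0 < lam := zero_lt_one.trans hgeom.one_lt
  have hLa := hgeom.pos a
  have hsub (n : ℕ) : Tendsto (fun K => K - n) U atTop := (tendsto_sub_atTop_nat n).mono_left hU
  set u : ℕ → C(ℤ → A, ℝ) → ℕ → ℝ := fun n f K => pullback P lam n (K - n) f (fun _ => a) / L a
  have hex (n : ℕ) (f : C(ℤ → A, ℝ)) : ∃ l, Tendsto (u n f) U (𝓝 l) := by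
    have hmem : ∀ K, u n f K ∈ Set.Icc (-(‖f‖ / m)) (‖f‖ / m) := fun K => by
      rw [Set.mem_Icc, ← abs_le, abs_div, abs_of_pos hLa, div_le_iff₀ hLa]
      exact abs_pullback_le P n hgeom hm0 hm (K - n) f fun _ => a
    obtain ⟨l, -, hl⟩ := (isCompact_Icc (a := -(‖f‖ / m)) (b := ‖f‖ / m)).ultrafilter_le_nhds'
      (U.map (u n f)) (Ultrafilter.mem_map.2 (Filter.mem_of_superset univ_mem fun K _ => hmem K))
    exact ⟨l, hl⟩
  choose Λ hΛ using hex
  have huniq {n : ℕ} {f : C(ℤ → A, ℝ)} {l : ℝ} (h : Tendsto (u n f) U (𝓝 l)) : Λ n f = l :=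
    tendsto_nhds_unique (hΛ n f) h
  -- Both levels are reached from the same top level `K`, so the relation is exact as soon as `K >
  -- n`, where the truncated subtraction is harmless.
  have hdual (n : ℕ) (f : C(ℤ → A, ℝ)) : Λ n f = Λ (n + 1) ((P n).dual lam f) := by
    refine huniq ((hΛ (n + 1) ((P n).dual lam f)).congr' ?_)
    filter_upwards [hU (eventually_gt_atTop n)] with K hK
    have e : K - n = K - (n + 1) + 1 := by
      have : n < K := hK
      omega
    simp only [u]
    rw [e, pullback_succ_eq_pullback_dual]
  have hlen (n : ℕ) : Λ n (letterFun L) = 1 := by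
    refine huniq (tendsto_const_nhds.congr fun K => ?_)
    simp only [u]
    rw [pullback_letterFun_length P n hgeom, letterFun_apply, div_self hLa.ne']
  have hzero {n : ℕ} {f : C(ℤ → A, ℝ)} {r c : ℝ} (hr0 : 0 ≤ r) (hr1 : r < 1)
      (h : ∀ k, |pullback P lam n k f fun _ => a| ≤ r ^ k * c) : Λ n f = 0 := by
    refine huniq (squeeze_zero_norm (a := fun K => r ^ (K - n) * c / L a) (fun K => ?_) ?_)
    · rw [Real.norm_eq_abs, abs_div, abs_of_pos hLa]
      exact div_le_div_of_nonneg_right (h _) hLa.le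
    · have := (((tendsto_pow_atTop_nhds_zero_of_lt_one hr0 hr1).comp (hsub n)).mul_const
        c).div_const (L a)
      simpa using this
  have hadd (n : ℕ) (f g : C(ℤ → A, ℝ)) : Λ n (f + g) = Λ n f + Λ n g := by
    refine huniq (((hΛ n f).add (hΛ n g)).congr fun K => ?_)
    simp only [u]
    rw [map_add, ContinuousMap.add_apply, add_div]
  have hsmul (n : ℕ) (c : ℝ) (f : C(ℤ → A, ℝ)) : Λ n (c • f) = c * Λ n f := by
    refine huniq (((hΛ n f).const_mul c).congr fun K => ?_)
    simp only [u]
    rw [map_smul, ContinuousMap.smul_apply, smul_eq_mul, mul_div_assoc]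
  have hpos (n : ℕ) (f : C(ℤ → A, ℝ)) (hf : 0 ≤ f) : 0 ≤ Λ n f := by
    refine ge_of_tendsto' (hΛ n f) fun K => div_nonneg ?_ hLa.le
    have := pullback_mono P n hlam.le (K - n) hf
    rw [map_zero] at this
    exact this _
  have hshift (n : ℕ) (f : C(ℤ → A, ℝ)) : Λ n (shiftComp f) = Λ n f := by
    have h0 : Λ n (shiftComp f - f) = 0 := by
      refine hzero (inv_nonneg.2 hlam.le) (inv_lt_one_of_one_lt₀ hgeom.one_lt)
        (c := 2 * ‖f‖) fun k => ?_
      obtain ⟨g, h1, h2⟩ := exists_pullback_shiftComp_sub P (lam := lam) n k f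
      rw [h2, ContinuousMap.smul_apply, smul_eq_mul, abs_mul, abs_of_nonneg (by positivity)]
      refine mul_le_mul_of_nonneg_left ?_ (by positivity)
      have h3 := abs_le.1 ((g.norm_coe_le_norm (shift 1 fun _ => a)).trans h1)
      have h4 := abs_le.1 ((g.norm_coe_le_norm fun _ => a).trans h1)
      rw [ContinuousMap.sub_apply, shiftComp_apply, abs_le]
      constructor <;> linarith [h3.1, h3.2, h4.1, h4.2]
    have h1 := hadd n (shiftComp f - f) f
    rw [sub_add_cancel, h0, zero_add] at h1
    exact h1
  choose ρ hρfin hρ using fun n => exists_measure_integral_eq (Λ n) (hadd n) (hsmul n) (hpos n)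
  have hρinv (n : ℕ) : MeasurePreserving (shift 1) (ρ n) (ρ n) := by
    refine ⟨measurable_shift 1, ext_of_forall_integral_eq_of_IsFiniteMeasure fun f => ?_⟩
    rw [integral_map (measurable_shift 1).aemeasurable f.continuous.aestronglyMeasurable]
    have := hshift n f.toContinuousMap
    rw [← hρ, ← hρ] at this
    exact this
  have hρX (n : ℕ) : ρ n ϑ.subshiftᶜ = 0 := by
    refine measure_compl_subshift_eq_zero (hρinv n) fun N hN => ?_
    have hf := legalLE_clopenIndicator ϑ hN hq0 hq1
    have h0 : Λ n (clopenIndicator (isClopen_window_mem 0 N ϑ.languageᶜ)) = 0 := by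
      refine hzero hs0 hs1 (c := (q ^ N)⁻¹ * q) fun k => ?_
      -- Only the window of length one is used: the single letter `a` is legal, and exponential
      -- decay in `k` does the rest.
      have := hf.pullback P n hlam (by positivity) hq0.le hq1 k 1 one_ne_zero (fun _ => a)
        (by simpa [window_eq_map] using ϑ.singleton_mem_language a)
      refine this.trans_eq ?_
      ring
    rw [← hρ, integral_clopenIndicator, measureReal_def, ENNReal.toReal_eq_zero_iff] at h0
    exact h0.resolve_right (measure_ne_top _ _)
  have hρ0 (n : ℕ) : ρ n ≠ 0 := fun h => by
    have := hlen n
    rw [← hρ, h] at this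
    simp at this
  have hc0 (n : ℕ) : (ρ n Set.univ)⁻¹ ≠ 0 := ENNReal.inv_ne_zero.2 (measure_ne_top _ _)
  have hc (n : ℕ) : (ρ n Set.univ)⁻¹ ≠ ⊤ :=
    ENNReal.inv_ne_top.2 (Measure.measure_univ_ne_zero.2 (hρ0 n))
  -- The limit measures have mean length one rather than mass one; rescaling does not change
  -- `normalized`.
  let ν : ℕ → Measure (ℤ → A) := fun n => (ρ n Set.univ)⁻¹ • ρ n
  have hνΛ (n : ℕ) (f : C(ℤ → A, ℝ)) : normalized L (ν n) f = Λ n f := by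
    have h1 : ∫ x, L (x 0) ∂ρ n = 1 := (hρ n (letterFun L)).trans (hlen n)
    rw [normalized_smul_measure (hc0 n) (hc n), normalized, h1, hρ, inv_one, one_mul]
  have hνprob (n : ℕ) : IsProbabilityMeasure (ν n) := ⟨by
    rw [Measure.smul_apply, smul_eq_mul, ENNReal.inv_mul_cancel
      (Measure.measure_univ_ne_zero.2 (hρ0 n)) (measure_ne_top _ _)]⟩
  have hνX (n : ℕ) : ν n ϑ.subshiftᶜ = 0 := by
    rw [Measure.smul_apply, hρX, smul_zero]
  refine ⟨ν, ⟨fun n => ⟨hνprob n, ⟨measurable_shift 1, ?_⟩, hνX n⟩, fun n => ?_⟩, fun n f => ?_⟩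
  · rw [Measure.map_smul, (hρinv n).map_eq]
  · have := (P n).isProbabilityMeasure_transfer hrec (hνX (n + 1))
    refine eq_of_normalized_eq hgeom.pos fun f => ?_
    rw [(P n).normalized_transfer hgeom hrec (hνX (n + 1)), hνΛ, hνΛ, hdual]
  · rw [hνΛ]
    exact hΛ n f

end Existence

end RandomSubst

end

/-! ### The equivalence -/

theorem mainTheorem5 {A : Type*} [Fintype A] [DecidableEq A]
    [MeasurableSpace A] [DiscreteMeasurableSpace A]
    (ϑ : RandomSubst.RandomSubstitution A) (lam : ℝ) (L : A → ℝ)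
    (hprim : ϑ.IsPrimitive) (hgeom : ϑ.GeometricallyCompatible lam L)
    (hrec : ϑ.IsRecognisable) (P : ℕ → RandomSubst.ProbabilityChoice ϑ) :
    (∃! μ : MeasureTheory.Measure (ℤ → A), RandomSubst.IsInverseLimitMeasure P μ) ↔
      RandomSubst.IsErgodicInverseTime fun n => (P n).geometricMatrix lam L := by
  open MeasureTheory Filter Topology RandomSubst in
  let _ : TopologicalSpace A := ⊥
  have : DiscreteTopology A := ⟨rfl⟩
  constructor
  · rintro ⟨μ, ⟨ν, hν, rfl⟩, huniq⟩ n
    have := (hν.1 n).1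
    refine ⟨letterWeight L (ν n), letterWeight_nonneg hgeom.pos, sum_letterWeight hgeom.pos, ?_⟩
    refine tendsto_pi_nhds.2 fun b => tendsto_pi_nhds.2 fun a => ?_
    -- Convergence is tested along ultrafilters. Each one, with column `a`, produces an adapted
    -- sequence, which must be `ν` by uniqueness at level `0` and injectivity of the transfer; so
    -- the limit depends neither on the ultrafilter nor on `a`.
    have key : Tendsto (fun K => ((List.range (K - n)).map fun i =>
        (P (n + i)).geometricMatrix lam L).prod b a) atTop (𝓝 (letterWeight L (ν n) b)) := by
      refine tendsto_iff_ultrafilter _ _ _ |>.2 fun U hU => ?_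
      obtain ⟨ν', hν', hlim⟩ := exists_isAdapted_tendsto hgeom hrec P a U hU
      obtain rfl := hν.eq_of_eq_zero hrec hν' (huniq _ ⟨ν', hν', rfl⟩).symm
      refine (hlim n (letterFun (Pi.single b (L b)))).congr fun K => ?_
      rw [pullback_letterFun_single P n hgeom, ContinuousMap.sum_apply,
        Finset.sum_eq_single a (fun c _ hc => by simp [hc.symm]) (by simp)]
      simp [(hgeom.pos a).ne']
    -- With `K = k + n + 1` the product has the required `k + 1` factors.
    have := key.comp (tendsto_add_atTop_nat (n + 1))
    refine (this.congr fun k => ?_).trans_eq (by simp [Matrix.vecMulVec_apply])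
    simp [show k + (n + 1) - n = k + 1 by omega]
  · intro h
    choose p hp0 hp1 hp using h
    -- On an empty alphabet no vector sums to one.
    have : Nonempty A := by
      by_contra hA
      rw [not_nonempty_iff] at hA
      simpa using hp1 0
    obtain ⟨a⟩ := this
    obtain ⟨ν, hν, -⟩ :=
      exists_isAdapted_tendsto hgeom hrec P a (hyperfilter ℕ) Nat.hyperfilter_le_atTop
    refine ⟨ν 0, ⟨ν, hν, rfl⟩, ?_⟩
    rintro _ ⟨ν', hν', rfl⟩
    refine hν'.eq_of_letterWeight_eq hgeom hrec hν fun n => ?_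
    rw [hν.letterWeight_eq_of_tendsto hgeom hrec (hp n),
      hν'.letterWeight_eq_of_tendsto hgeom hrec (hp n)]
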